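/- Let $f\colon Y\to X$ be a proper birational morphism between Noetherian normal schemes, and let $\omega_Y$ be a dualizing sheaf on $Y$, that is, a coherent sheaf whose stalk at every $y\in Y$ is a canonical module of $\mathcal O_{Y,y}$ (for a normal variety $Y$ over a field this includes the usual dualizing sheaf). Let $E\subset Y$ be the reduced full exceptional divisor of $f$, i.e. the union, with its reduced structure, of all prime divisors of $Y$ contained in the exceptional locus of $f$ (the set of points at which $f$ is not a local isomorphism), and assume that $E$ is Cartier. For $m\ge 1$ let $\omega_Y^{[m]}=(\omega_Y^{\otimes m})^{\vee\vee}$ be the reflexive power. Then for every integer $m>0$ there is an integer $a_0$ such that for all $a\ge a_0$ the natural map $$H^1_E\bigl(Y,\omega_Y^{[m]}(aE)\bigr)\longrightarrow H^1\bigl(Y,\omega_Y^{[m]}(aE)\bigr)$$ is injective, where $H^1_E$ denotes cohomology with support in $E$. In particular, if $\omega_Y$ is invertible (for example if $Y$ is Gorenstein, or a smooth variety), then for every $m>0$ and all sufficiently large $a$ the natural map $$H^1_E\bigl(Y,\omega_Y^{\otimes m}(aE)\bigr)\longrightarrow H^1\bigl(Y,\omega_Y^{\otimes m}(aE)\bigr)$$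 is injective. -/

import Mathlib

open CategoryTheory AlgebraicGeometry TopologicalSpace Opposite Limits MonoidalCategory
universe u
namespace PluriCanon
noncomputable section

/-- The sections of a presheaf of modules over `U` form a module over `Γ(Y, U)`. -/
instance presheafSectionsModule {Y : Scheme.{u}} (P : Y.PresheafOfModules) (U : Y.Opens) :
    Module Γ(Y, U) (P.presheaf.obj (op U)) :=
  (P.obj (op U)).isModule

lemma presheaf_map_smul {Y : Scheme.{u}} (P : Y.PresheafOfModules) {V U : Y.Opens} (i : V ⟶ U)
    (r : Γ(Y, U)) (x : P.presheaf.obj (op U)) :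
    P.presheaf.map i.op (r • x) = Y.presheaf.map i.op r • P.presheaf.map i.op x :=
  P.map_smul i.op r x

/-- A section over `W` of the sheaf of homomorphisms from `P` to `N`, that is, a morphism of
presheaves of modules `P|_W ⟶ N|_W`: linear maps `P(V) → N(V)` for all open `V ⊆ W`,
compatible with restriction. -/
def homSections {Y : Scheme.{u}} (P : Y.PresheafOfModules) (N : Y.Modules) (W : Y.Opens) :
    AddSubgroup (∀ V : {V : Y.Opens // V ≤ W}, P.presheaf.obj (op V.1) →ₗ[Γ(Y, V.1)] Γ(N, V.1)) where
  carrier := {φ | ∀ (V V' : {V : Y.Opens // V ≤ W}) (i : V'.1 ⟶ V.1)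
    (x : P.presheaf.obj (op V.1)),
    φ V' (P.presheaf.map i.op x) = N.presheaf.map i.op (φ V x)}
  zero_mem' := by
    intro V V' i x
    change (0 : Γ(N, V'.1)) = N.presheaf.map i.op (0 : Γ(N, V.1))
    rw [map_zero]
  add_mem' := by
    intro φ ψ hφ hψ V V' i x
    simp only [Pi.add_apply, LinearMap.add_apply, map_add]
    rw [hφ, hψ]
  neg_mem' := by
    intro φ hφ V V' i x
    simp only [Pi.neg_apply, LinearMap.neg_apply, map_neg]
    rw [hφ]

/-- `(r • φ)(x) = r|_V • φ(x)` for `r ∈ Γ(Y, W)` and `x ∈ P(V)`. -/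
instance homSectionsSMul {Y : Scheme.{u}} (P : Y.PresheafOfModules) (N : Y.Modules)
    (W : Y.Opens) : SMul Γ(Y, W) (homSections P N W) where
  smul r φ := ⟨fun V => (Y.presheaf.map (homOfLE V.2).op).hom r • φ.1 V, by
    intro V V' i x
    simp only [LinearMap.smul_apply, Scheme.Modules.map_smul]
    rw [φ.2 V V' i x, ← ConcreteCategory.comp_apply, ← Functor.map_comp]
    rfl⟩

lemma homSections_smul_val {Y : Scheme.{u}} (P : Y.PresheafOfModules) (N : Y.Modules)
    (W : Y.Opens) (r : Γ(Y, W)) (φ : homSections P N W) (V : {V : Y.Opens // V ≤ W}) :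
    (r • φ).1 V = (Y.presheaf.map (homOfLE V.2).op).hom r • φ.1 V := rfl

instance homSectionsModule {Y : Scheme.{u}} (P : Y.PresheafOfModules) (N : Y.Modules)
    (W : Y.Opens) : Module Γ(Y, W) (homSections P N W) where
  one_smul φ := Subtype.ext (funext fun V => by
    rw [homSections_smul_val, map_one, one_smul])
  mul_smul r s φ := Subtype.ext (funext fun V => by
    rw [homSections_smul_val, homSections_smul_val, homSections_smul_val, map_mul, mul_smul])
  smul_zero r := Subtype.ext (funext fun V => by
    rw [homSections_smul_val]
    exact smul_zero _)
  smul_add r φ ψ := Subtype.ext (funext fun V => by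
    rw [homSections_smul_val]
    exact smul_add _ _ _)
  add_smul r s φ := Subtype.ext (funext fun V => by
    rw [homSections_smul_val, map_add, add_smul]
    rfl)
  zero_smul φ := Subtype.ext (funext fun V => by
    rw [homSections_smul_val, map_zero, zero_smul]
    rfl)

/-- The abelian presheaf `W ↦ Hom(P|_W, N|_W)`. -/
def homAbPresheaf {Y : Scheme.{u}} (P : Y.PresheafOfModules) (N : Y.Modules) :
    TopCat.Presheaf Ab.{u} Y where
  obj W := AddCommGrpCat.of (homSections P N W.unop)
  map j := AddCommGrpCat.ofHom
    { toFun := fun φ => ⟨fun V => φ.1 ⟨V.1, V.2.trans (leOfHom j.unop)⟩,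
        fun V V' i x => φ.2 ⟨V.1, _⟩ ⟨V'.1, _⟩ i x⟩
      map_zero' := rfl
      map_add' := fun _ _ => rfl }
  map_id _ := rfl
  map_comp _ _ := rfl

lemma homAbPresheaf_map_apply {Y : Scheme.{u}} (P : Y.PresheafOfModules) (N : Y.Modules)
    {W W' : Y.Opens} (j : W' ⟶ W) (φ : homSections P N W) (V : {V : Y.Opens // V ≤ W'}) :
    Subtype.val (p := fun ψ => ψ ∈ homSections P N W') ((homAbPresheaf P N).map j.op φ) V =
      φ.1 ⟨V.1, V.2.trans (leOfHom j)⟩ := rfl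

set_option maxHeartbeats 1000000 in
lemma homAbPresheaf_isSheaf {Y : Scheme.{u}} (P : Y.PresheafOfModules) (N : Y.Modules) :
    (homAbPresheaf P N).IsSheaf := by
  rw [TopCat.Presheaf.isSheaf_iff_isSheafUniqueGluing]
  intro ι U sf hsf
  let NS : TopCat.Sheaf Ab.{u} Y := ⟨N.presheaf, N.isSheaf⟩
  -- the local pieces
  let sf' : ∀ i, homSections P N (U i) := sf
  have hcompat : ∀ (i j : ι) (V : Y.Opens) (hi : V ≤ U i) (hj : V ≤ U j),
      (sf' i).1 ⟨V, hi⟩ = (sf' j).1 ⟨V, hj⟩ := by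
    intro i j V hi hj
    exact congrFun (congrArg Subtype.val (hsf i j)) ⟨V, le_inf hi hj⟩
  have key : ∀ (V : Y.Opens) (hV : V ≤ iSup U) (x : P.presheaf.obj (op V)),
      ∃! s : Γ(N, V), ∀ i, N.presheaf.map (homOfLE (inf_le_left : V ⊓ U i ≤ V)).op s =
        (sf' i).1 ⟨V ⊓ U i, inf_le_right⟩
          (P.presheaf.map (homOfLE (inf_le_left : V ⊓ U i ≤ V)).op x) := by
    intro V hV x
    refine NS.existsUnique_gluing' (fun i => V ⊓ U i) V
      (fun i => homOfLE inf_le_left) ?_ _ ?_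
    · intro y hy
      obtain ⟨i, hi⟩ := Opens.mem_iSup.mp (hV hy)
      exact Opens.mem_iSup.mpr ⟨i, hy, hi⟩
    · intro i j
      change N.presheaf.map _ _ = N.presheaf.map _ _
      rw [← (sf' i).2 ⟨V ⊓ U i, inf_le_right⟩
          ⟨(V ⊓ U i) ⊓ (V ⊓ U j), inf_le_left.trans inf_le_right⟩
          (Opens.infLELeft (V ⊓ U i) (V ⊓ U j)),
        ← (sf' j).2 ⟨V ⊓ U j, inf_le_right⟩
          ⟨(V ⊓ U i) ⊓ (V ⊓ U j), inf_le_right.trans inf_le_right⟩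
          (Opens.infLERight (V ⊓ U i) (V ⊓ U j)),
        ← ConcreteCategory.comp_apply, ← ConcreteCategory.comp_apply,
        ← Functor.map_comp, ← Functor.map_comp]
      rw [hcompat i j]
      rfl
  choose g hg hguniq using fun V hV x => (key V hV x)
  have hext : ∀ (V : Y.Opens) (hV : V ≤ iSup U) (s t : Γ(N, V)),
      (∀ i, N.presheaf.map (homOfLE (inf_le_left : V ⊓ U i ≤ V)).op s =
        N.presheaf.map (homOfLE (inf_le_left : V ⊓ U i ≤ V)).op t) → s = t := by
    intro V hV s t h
    refine NS.eq_of_locally_eq' (fun i => V ⊓ U i) V (fun i => homOfLE inf_le_left) ?_ s t h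
    intro y hy
    obtain ⟨i, hi⟩ := Opens.mem_iSup.mp (hV hy)
    exact Opens.mem_iSup.mpr ⟨i, hy, hi⟩
  let glued : homSections P N (iSup U) := ⟨fun V =>
    { toFun := g V.1 V.2
      map_add' := fun x y => hext _ V.2 _ _ fun i => by
        rw [map_add, hg, hg, hg, map_add, map_add]
      map_smul' := fun r x => hext _ V.2 _ _ fun i => by
        rw [hg, presheaf_map_smul, map_smul, RingHom.id_apply, Scheme.Modules.map_smul, hg] }, by
    intro V V' i x
    refine hext _ V'.2 _ _ fun k => ?_
    change N.presheaf.map _ (g V'.1 V'.2 _) = N.presheaf.map _ (N.presheaf.map _ (g V.1 V.2 x))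
    rw [hg]
    have h1 := congrArg (N.presheaf.map (homOfLE (inf_le_inf_right (U k) (leOfHom i) :
      V'.1 ⊓ U k ≤ V.1 ⊓ U k)).op) (hg V.1 V.2 x k)
    rw [← (sf' k).2 ⟨V.1 ⊓ U k, inf_le_right⟩ ⟨V'.1 ⊓ U k, inf_le_right⟩] at h1
    rw [← ConcreteCategory.comp_apply, ← ConcreteCategory.comp_apply,
      ← Functor.map_comp, ← Functor.map_comp] at h1 ⊢
    exact h1.symm⟩
  refine ⟨glued, ?_, ?_⟩
  · intro i
    refine Subtype.ext (funext fun V => LinearMap.ext fun x => ?_)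
    change g V.1 (V.2.trans (le_iSup U i)) x = (sf' i).1 V x
    refine hext _ (V.2.trans (le_iSup U i)) _ _ fun k => ?_
    rw [hg, ← (sf' i).2 V ⟨V.1 ⊓ U k, inf_le_left.trans V.2⟩]
    exact LinearMap.congr_fun (hcompat k i (V.1 ⊓ U k) inf_le_right (inf_le_left.trans V.2)) _
  · intro t ht
    let t' : homSections P N (iSup U) := t
    refine Subtype.ext (funext fun V => LinearMap.ext fun x => ?_)
    change t'.1 V x = g V.1 V.2 x
    refine hguniq _ _ _ _ fun k => ?_
    change N.presheaf.map _ (t'.1 V x) = _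
    rw [← t'.2 V ⟨V.1 ⊓ U k, inf_le_left.trans V.2⟩]
    have := congrFun (congrArg Subtype.val (ht k)) ⟨V.1 ⊓ U k, inf_le_right⟩
    exact LinearMap.congr_fun this _

/-- The sheaf of homomorphisms `ℋom(P, N)`, with sections `Hom(P|_W, N|_W)` over `W`. Since `N` is a
sheaf, it is also the sheaf of homomorphisms from the sheaf associated with `P` to `N`. -/
def homSheaf {Y : Scheme.{u}} (P : Y.PresheafOfModules) (N : Y.Modules) : Y.Modules :=
  letI : ∀ W, Module (Y.ringCatSheaf.obj.obj W) ((homAbPresheaf P N).obj W) :=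
    fun W => homSectionsModule P N W.unop
  { val := PresheafOfModules.ofPresheaf (homAbPresheaf P N) (by
      intro W W' j r φ
      refine Subtype.ext (funext fun V => ?_)
      exact congrArg (fun s : Γ(Y, V.1) => s • φ.1 ⟨V.1, V.2.trans (leOfHom j.unop)⟩)
        (ConcreteCategory.congr_hom (Y.presheaf.map_comp j (homOfLE V.2).op) r))
    isSheaf := homAbPresheaf_isSheaf P N }


/-- The dual `P^∨ = ℋom(P, 𝒪_Y)`. -/
def dual {Y : Scheme.{u}} (P : Y.PresheafOfModules) : Y.Modules :=
  homSheaf P (SheafOfModules.unit Y.ringCatSheaf)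

/-- The `m`-fold tensor power of a presheaf of modules. -/
def tensorPowerAux {Y : Scheme.{u}}
    (P : PresheafOfModules (Y.presheaf ⋙ forget₂ CommRingCat RingCat)) :
    ℕ → PresheafOfModules (Y.presheaf ⋙ forget₂ CommRingCat RingCat)
  | 0 => 𝟙_ _
  | m + 1 => tensorPowerAux P m ⊗ P

/-- The presheaf tensor power `U ↦ M(U)^{⊗ m}` (over `𝒪_Y(U)`). -/
def presheafTensorPower {Y : Scheme.{u}} (M : Y.Modules) (m : ℕ) : Y.PresheafOfModules :=
  tensorPowerAux (Y := Y) M.val m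

/-- The tensor power `M^{⊗ m}` over `𝒪_Y`, the sheaf associated with `U ↦ M(U)^{⊗ m}`. -/
def tensorPower {Y : Scheme.{u}} (M : Y.Modules) (m : ℕ) : Y.Modules :=
  (PresheafOfModules.sheafification (𝟙 Y.ringCatSheaf.obj)).obj (presheafTensorPower M m)

/-- The reflexive power `M^{[m]} = (M^{⊗ m})^{∨∨}`. Morphisms into the sheaf `𝒪_Y` out of the
presheaf `U ↦ M(U)^{⊗ m}` and out of the associated sheaf `M^{⊗ m}` are the same, over every open
set, so the inner dual can be formed with either. -/
def reflexivePower {Y : Scheme.{u}} (M : Y.Modules) (m : ℕ) : Y.Modules :=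
  dual (dual (presheafTensorPower M m)).val

/-- `M` is invertible: locally isomorphic to the structure sheaf. -/
def IsInvertible {Y : Scheme.{u}} (M : Y.Modules) : Prop :=
  ∀ y : Y, ∃ U : Y.Opens, y ∈ U ∧
    Nonempty (M.restrict U.ι ≅
      (SheafOfModules.unit (U : Scheme.{u}).ringCatSheaf : Scheme.Modules U))

/-- The sections over `U` of the ideal sheaf of the reduced closed subscheme with support `E`:
the functions vanishing at every point of `E ∩ U`. -/
def reducedIdeal {Y : Scheme.{u}} (E : Closeds Y) (U : Y.Opens) : Ideal Γ(Y, U) :=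
  ⨅ y : {y : U // (y : Y) ∈ E},
    (IsLocalRing.maximalIdeal (Y.presheaf.stalk (y.1 : Y))).comap
      (Y.presheaf.germ U y.1 y.1.2).hom

lemma mem_reducedIdeal {Y : Scheme.{u}} (E : Closeds Y) (U : Y.Opens) (s : Γ(Y, U)) :
    s ∈ reducedIdeal E U ↔ ∀ (y : Y) (hy : y ∈ U), y ∈ E →
      Y.presheaf.germ U y hy s ∈ IsLocalRing.maximalIdeal (Y.presheaf.stalk y) := by
  simp only [reducedIdeal, Ideal.mem_iInf, Ideal.mem_comap, Subtype.forall]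

lemma reducedIdeal_map_le {Y : Scheme.{u}} (E : Closeds Y) {V U : Y.Opens} (i : V ⟶ U) :
    (reducedIdeal E U).map (Y.presheaf.map i.op).hom ≤ reducedIdeal E V := by
  rw [Ideal.map_le_iff_le_comap]
  intro s hs
  rw [Ideal.mem_comap, mem_reducedIdeal]
  intro y hy hyE
  have h := (mem_reducedIdeal E U s).mp hs y (leOfHom i hy) hyE
  rwa [← TopCat.Presheaf.germ_res_apply Y.presheaf i y hy s] at h

/-- The presheaf `U ↦ I(U)^a` where `I` is the ideal sheaf of the reduced closed subscheme with
support `E`; the associated sheaf is the ideal sheaf `I^a`. -/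
def idealPowerPresheaf {Y : Scheme.{u}} (E : Closeds Y) (a : ℕ) : Y.PresheafOfModules :=
  PresheafOfModules.Submodule.toPresheafOfModules
    (M := PresheafOfModules.unit Y.ringCatSheaf.obj)
    { obj := fun U => (reducedIdeal E U.unop ^ a : Ideal Γ(Y, U.unop))
      map := by
        intro U V f x hx
        have h : (reducedIdeal E U.unop ^ a).map (Y.presheaf.map f).hom ≤
            reducedIdeal E V.unop ^ a := by
          rw [Ideal.map_pow]
          exact Ideal.pow_right_mono (reducedIdeal_map_le E f.unop) a
        exact h (Ideal.mem_map_of_mem (Y.presheaf.map f).hom hx) }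

/-- The reduced closed subscheme with support `E` is an effective Cartier divisor: its ideal sheaf
is locally generated by one nonzerodivisor. -/
def IsCartier {Y : Scheme.{u}} (E : Closeds Y) : Prop :=
  ∀ y : Y, ∃ U : Y.Opens, IsAffineOpen U ∧ y ∈ U ∧
    ∃ g ∈ nonZeroDivisors Γ(Y, U), reducedIdeal E U = Ideal.span {g}

/-- The twist `F(aE)` for a reduced effective Cartier divisor with support `E` and ideal sheaf `I`:
as `I` is invertible, `F(aE) = F ⊗ 𝒪_Y(aE) = F ⊗ (I^a)^{-1}` is `ℋom(I^a, F)`. -/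
def twist {Y : Scheme.{u}} (F : Y.Modules) (E : Closeds Y) (a : ℕ) : Y.Modules :=
  homSheaf (idealPowerPresheaf E a) F

/-- A scheme is normal if all its local rings are integrally closed domains. -/
def IsNormal (Y : Scheme.{u}) : Prop :=
  ∀ y : Y, IsDomain (Y.presheaf.stalk y) ∧ IsIntegrallyClosed (Y.presheaf.stalk y)

/-- `f` is birational: it is an isomorphism over a dense open subset of the target whose
preimage is dense. -/
def IsBirational {Y X : Scheme.{u}} (f : Y ⟶ X) : Prop :=
  ∃ U : X.Opens, Dense (U : Set X) ∧ Dense ((f ⁻¹ᵁ U : Y.Opens) : Set Y) ∧ IsIso (f ∣_ U)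

/-- The exceptional locus of `f`: the points at which `f` is not a local isomorphism. -/
def exceptionalLocus {Y X : Scheme.{u}} (f : Y ⟶ X) : Set Y :=
  {y | ¬ ∃ U : Y.Opens, y ∈ U ∧ IsOpenImmersion (U.ι ≫ f)}

/-- The support of the full exceptional divisor: the union of the prime divisors contained in the
exceptional locus (a finite union when `Y` is Noetherian and normal). A prime divisor is the closure
of a point whose local ring has dimension one. -/
def exceptionalDivisor {Y X : Scheme.{u}} (f : Y ⟶ X) : Closeds Y :=
  ⟨closure {y | y ∈ exceptionalLocus f ∧ ringKrullDim (Y.presheaf.stalk y) = 1}, isClosed_closure⟩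

/-- `E` is an injective hull of `M`: it is injective and an essential extension of `M`. -/
def IsInjectiveHull {R : Type u} [CommRing R] (M E : Type u) [AddCommGroup M] [Module R M]
    [AddCommGroup E] [Module R E] : Prop :=
  Module.Injective R E ∧ ∃ i : M →ₗ[R] E, Function.Injective i ∧
    ∀ N : Submodule R E, N ≠ ⊥ → N ⊓ LinearMap.range i ≠ ⊥

/-- `K` is a canonical module of the Noetherian local ring `(R, 𝔪, k)` of dimension `d`: a finitely
generated module with `Hom_R(K, E(k)) ≅ H^d_𝔪(R)`, where `E(k)` is the injective hull of `k`. -/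
def IsCanonicalModule (R : Type u) [CommRing R] [IsLocalRing R] (K : Type u) [AddCommGroup K]
    [Module R K] : Prop :=
  Module.Finite R K ∧ ∃ d : ℕ, ringKrullDim R = d ∧
    ∃ E : ModuleCat.{u} R, IsInjectiveHull (R := R) (IsLocalRing.ResidueField R) E ∧
      Nonempty ((K →ₗ[R] E) ≃ₗ[R]
        (localCohomology (IsLocalRing.maximalIdeal R) d).obj (ModuleCat.of R R))

/-- The stalk of an `𝒪_Y`-module is a module over the local ring. -/
instance stalkModule {Y : Scheme.{u}} (M : Y.Modules) (y : Y) :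
    Module (Y.presheaf.stalk y) (M.presheaf.stalk y) :=
  letI P : PresheafOfModules (Y.presheaf ⋙ forget₂ CommRingCat RingCat) := M.val
  inferInstanceAs (Module (Y.presheaf.stalk y) ↑(TopCat.Presheaf.stalk P.presheaf y))

/-- `ω` is a dualizing sheaf on the locally Noetherian normal scheme `Y`: a coherent sheaf whose
stalks are canonical modules of the local rings. -/
def IsDualizingSheaf {Y : Scheme.{u}} (ω : Y.Modules) : Prop :=
  SheafOfModules.IsFinitePresentation (R := Y.ringCatSheaf) ω ∧
    ∀ y : Y, IsCanonicalModule (Y.presheaf.stalk y) (ω.presheaf.stalk y)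

/-- The abelian sheaf underlying an `𝒪_Y`-module. -/
def toAb {Y : Scheme.{u}} (M : Y.Modules) :
    Sheaf (Opens.grothendieckTopology Y) AddCommGrpCat.{u} :=
  (SheafOfModules.toSheaf Y.ringCatSheaf).obj M

/-- The functor `U ↦ ℤ_U` from open subsets to abelian sheaves on `Y`, where `ℤ_U` is the
extension by zero of the constant sheaf `ℤ` on `U`: the free abelian sheaf on `U`. -/
def freeAb (Y : Scheme.{u}) :
    Y.Opens ⥤ Sheaf (Opens.grothendieckTopology Y) AddCommGrpCat.{u} :=
  yoneda ⋙ (Functor.whiskeringRight _ _ _).obj AddCommGrpCat.free ⋙ presheafToSheaf _ _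

/-- The open complement of a closed subset. -/
def openCompl {Y : Scheme.{u}} (E : Closeds Y) : Y.Opens := E.compl

/-- The constant sheaf `ℤ_E` supported on the closed subset `E`: the cokernel of the inclusion
`ℤ_{Y \ E} → ℤ_Y`. Morphisms `ℤ_E ⟶ F` are the global sections of `F` with support in `E`. -/
def supportSheaf {Y : Scheme.{u}} (E : Closeds Y) :
    Sheaf (Opens.grothendieckTopology Y) AddCommGrpCat.{u} :=
  cokernel ((freeAb Y).map (homOfLE (le_top : openCompl E ≤ (⊤ : Y.Opens))))

/-- The local cohomology group `H^n_E(Y, F) = Ext^n(ℤ_E, F)`, the `n`-th right derived functor of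
`Γ_E(Y, -) = Hom(ℤ_E, -)`. -/
abbrev HSupp {Y : Scheme.{u}} (E : Closeds Y)
    (F : Sheaf (Opens.grothendieckTopology Y) AddCommGrpCat.{u}) (n : ℕ) : Type u :=
  Abelian.Ext.{u} (supportSheaf E) F n

/-- The natural map `H^n_E(Y, F) → H^n(Y, F)`, induced by `ℤ_Y → ℤ_E` (that is, by the inclusion
`Γ_E(Y, -) ⊆ Γ(Y, -)`). -/
def HSuppToH {Y : Scheme.{u}} (E : Closeds Y)
    (F : Sheaf (Opens.grothendieckTopology Y) AddCommGrpCat.{u}) (n : ℕ) :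
    HSupp E F n →+ Sheaf.H'.{u} F n (⊤ : Y.Opens) :=
  (Abelian.Ext.mk₀ (cokernel.π
    ((freeAb Y).map (homOfLE (le_top : openCompl E ≤ (⊤ : Y.Opens)))))).precomp F (zero_add n)

end
end PluriCanon

/-!
Since `ℤ_E` is the cokernel of `ℤ_{Y \ E} → ℤ_Y`, the map `H¹_E(Y, G) → H¹(Y, G)` is injective as
soon as every section of `G` over `Y \ E` extends to `Y` (`HSuppToH_injective`). For `G = F(aE)`
this says that every section of `F` over `Y \ E` has, locally on `Y`, a pole of order at most `a`
along `E` (`twist_map_surjective`). So the theorem is a boundedness statement: one `a₀` works for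
all sections of `F` over `Y \ E`.

It holds for every `F` that is locally finitely generated and torsionless (finitely many
functionals separate its sections), on account of the following finiteness. Let `W ⊆ X` be an
integral affine open set with ring `A`, and let `U ⊆ f⁻¹(W)` be an affine open set on which `F`
has separating functionals `φ₁, …, φ_r`. A point of codimension one of `X` has a valuation ring as
its local ring, so `f` is an isomorphism near it by the valuative criterion
(`exists_isIso_morphismRestrict`), and `E` does not meet its fibre. Since a Noetherian normal
domain is the intersection of its localizations that are valuation rings
(`dvd_of_forall_valuationRing`), a function on an open piece of `f⁻¹(W)` that is regular near
those fibres comes from `A` (`exists_eq_appLE`). As `Y` is quasi-compact and `F` is locally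
finitely generated, one nonzero `d ∈ A` makes all `d • φₖ(s)` of this kind, for all sections `s`
over `Y \ E` (`exists_denominator_of_functional`). Hence the vectors `(d • φₖ(s))ₖ` lie in the
Noetherian `A`-module `A^r`. Each single `s` has a pole of finite order along `E`
(`exists_res_eq_pow_smul`), and the submodules of `A^r` belonging to the sections with poles of
order at most `n` increase with `n`, so they become stationary: this is the uniform bound
(`exists_uniform_pow`). Finitely many such `U` cover `Y`.

The hypotheses on `F` are satisfied in the two cases. A dualizing sheaf `ω` is finitely presented,
hence locally finitely generated (`exists_finGen`), and so are its presheaf tensor powers; the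
dual of a finitely generated presheaf is finitely generated (`FinGen.dual`) and torsionless
(`FinGen.torsionless_dual`), so the bidual `ω^{[m]}` has both properties. If `ω` is invertible,
then the tensor powers are locally free with one basis element, whose coordinate is a separating
functional (`IsBasis.torsionless_sheafify`).
-/

namespace PluriCanon
noncomputable section

/-! ### Extension of sections and cohomology with support -/

section
open Abelian

/-- In the long exact sequence of `0 → im i → B → coker i → 0`, the connecting map
`Hom(im i, F) → Ext¹(coker i, F)` vanishes when homomorphisms to `F` extend along `i`. -/
lemma ext_precomp_cokernel_injective {C : Type*} [Category* C] [Abelian C] [HasExt.{u} C]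
    {A B F : C} (i : A ⟶ B) (h : ∀ φ : A ⟶ F, ∃ ψ : B ⟶ F, i ≫ ψ = φ) :
    Function.Injective ((Ext.mk₀ (cokernel.π i)).precomp F (zero_add 1)) := by
  rw [injective_iff_map_eq_zero]
  intro x hx
  let S : ShortComplex C := ShortComplex.mk (Abelian.image.ι i) (cokernel.π i)
    (kernel.condition _)
  have hS : S.ShortExact :=
    { exact := ShortComplex.exact_kernel _
      mono_f := inferInstanceAs (Mono (kernel.ι _))
      epi_g := inferInstanceAs (Epi (cokernel.π i)) }
  obtain ⟨x₁, rfl⟩ := Ext.contravariant_sequence_exact₃ hS F x hx (add_zero 1)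
  obtain ⟨φ, rfl⟩ := (Ext.mk₀_bijective _ _).2 x₁
  obtain ⟨ψ, hψ⟩ := h (Abelian.factorThruImage i ≫ φ)
  have : φ = S.f ≫ ψ := by
    rw [← cancel_epi (Abelian.factorThruImage i), ← hψ, ← Category.assoc]
    simp [S]
  rw [this, ← Ext.mk₀_comp_mk₀]
  exact hS.extClass_comp_assoc _

/-- Morphisms `ℤ_U ⟶ F` are sections of `F` over `U`, so they extend to `ℤ_V` when the sections
do. -/
lemma exists_freeAb_hom_ext {Y : Scheme.{u}}
    (F : Sheaf (Opens.grothendieckTopology Y) AddCommGrpCat.{u}) {U V : Y.Opens}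
    (i : U ⟶ V) (h : Function.Surjective (F.obj.map i.op))
    (φ : (freeAb Y).obj U ⟶ F) : ∃ ψ : (freeAb Y).obj V ⟶ F, (freeAb Y).map i ≫ ψ = φ := by
  let adj := (AddCommGrpCat.adj.{u}.whiskerRight (Y.Opensᵒᵖ)).comp
    (sheafificationAdjunction (Opens.grothendieckTopology Y) AddCommGrpCat.{u})
  let e := fun W : Y.Opens => adj.homEquiv (yoneda.obj W) F
  obtain ⟨t, ht⟩ := h (yonedaEquiv (e U φ))
  refine ⟨(e V).symm (yonedaEquiv.symm t), (e U).injective ?_⟩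
  have h1 : e U ((freeAb Y).map i ≫ (e V).symm (yonedaEquiv.symm t)) =
      yoneda.map i ≫ e V ((e V).symm (yonedaEquiv.symm t)) :=
    adj.homEquiv_naturality_left (yoneda.map i) _
  refine h1.trans ?_
  rw [Equiv.apply_symm_apply]
  apply yonedaEquiv.injective
  refine Eq.trans ?_ ht
  refine (yonedaEquiv_naturality _ i).symm.trans ?_
  rw [Equiv.apply_symm_apply]
  rfl

/-- The map `H¹_E(Y, F) → H¹(Y, F)` is injective if all sections off `E` extend to `Y`. -/
lemma HSuppToH_injective {Y : Scheme.{u}} (E : Closeds Y)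
    (F : Sheaf (Opens.grothendieckTopology Y) AddCommGrpCat.{u})
    (h : Function.Surjective (F.obj.map (homOfLE (le_top : openCompl E ≤ (⊤ : Y.Opens))).op)) :
    Function.Injective (HSuppToH E F 1) :=
  ext_precomp_cokernel_injective _ (exists_freeAb_hom_ext F _ h)

end

/-! ### Divisibility in Noetherian normal domains -/

section
/-- If `w / c` maps a finitely generated nonzero ideal into itself, then it is integral, hence in
the integrally closed domain `B`. -/
lemma dvd_of_mul_ideal_le_of_isFractionRing {B : Type*} (K : Type*) [Field K] [CommRing B]
    [Algebra B K] [IsFractionRing B K] [IsDomain B] [IsIntegrallyClosed B]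
    {I : Ideal B} (hI : I ≠ ⊥) (hfg : I.FG) {w c : B} (hc : c ≠ 0)
    (h : ∀ x ∈ I, ∃ y ∈ I, w * x = c * y) : c ∣ w := by
  have hcK : algebraMap B K c ≠ 0 := by simpa using hc
  have key : IsIntegral B (algebraMap B K w / algebraMap B K c) := by
    let N : Submodule B K := Submodule.map (Algebra.linearMap B K) I
    refine isIntegral_of_smul_mem_submodule (R := B) (A := K) (M := K) N ?_
      (Submodule.FG.map _ hfg) _ ?_
    · intro h0
      apply hI
      rw [eq_bot_iff]
      intro x hx
      have : algebraMap B K x ∈ N := ⟨x, hx, rfl⟩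
      rw [h0] at this
      simpa using this
    · rintro _ ⟨x, hx, rfl⟩
      obtain ⟨y, hy, e⟩ := h x hx
      refine ⟨y, hy, ?_⟩
      have e' := congrArg (algebraMap B K) e
      rw [map_mul, map_mul] at e'
      simp only [Algebra.linearMap_apply, smul_eq_mul]
      rw [div_mul_eq_mul_div, e', mul_div_cancel_left₀ _ hcK]
  obtain ⟨z, hz⟩ := IsIntegrallyClosed.algebraMap_eq_of_integral key
  refine ⟨z, IsFractionRing.injective B K ?_⟩
  rw [map_mul, hz, mul_div_cancel₀ _ hcK]

lemma dvd_of_mul_ideal_le {B : Type*} [CommRing B] [IsDomain B] [IsIntegrallyClosed B]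
    {I : Ideal B} (hI : I ≠ ⊥) (hfg : I.FG) {w c : B} (hc : c ≠ 0)
    (h : ∀ x ∈ I, ∃ y ∈ I, w * x = c * y) : c ∣ w :=
  dvd_of_mul_ideal_le_of_isFractionRing (FractionRing B) hI hfg hc h

/-- A Noetherian normal domain is the intersection of its localizations that are valuation rings:
if `c` divides `b` in each of these, then `c` divides `b`. -/
lemma dvd_of_forall_valuationRing {A : Type*} [CommRing A] [IsDomain A] [IsNoetherianRing A]
    (hA : ∀ (P : Ideal A) [P.IsPrime], IsIntegrallyClosed (Localization.AtPrime P))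
    {b c : A} (hc : c ≠ 0)
    (h : ∀ (P : Ideal A) [P.IsPrime], ValuationRing (Localization.AtPrime P) →
      ∃ s ∉ P, c ∣ s * b) : c ∣ b := by
  by_contra hcb
  have hb0 : (Ideal.Quotient.mk (Ideal.span {c}) b) ≠ 0 := by
    rwa [Ne, Ideal.Quotient.eq_zero_iff_dvd]
  -- a prime `P = (c : w)` associated with `A / c`; it is shown that `A_P` is a valuation ring
  obtain ⟨P, hP, hle⟩ := exists_le_isAssociatedPrime_of_isNoetherianRing A _ hb0
  obtain ⟨hPp, w, hw⟩ := isAssociatedPrime_iff.mp hP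
  obtain ⟨w, rfl⟩ := Ideal.Quotient.mk_surjective w
  have memP : ∀ a, a ∈ P ↔ c ∣ a * w := by
    intro a
    rw [hw, Submodule.mem_colon_singleton, Submodule.mem_bot, ← Ideal.Quotient.eq_zero_iff_dvd,
      map_mul]
    rfl
  let B := Localization.AtPrime P
  let φ := algebraMap A B
  have hinj : Function.Injective φ := IsLocalization.injective B P.primeCompl_le_nonZeroDivisors
  have : IsDomain B := IsLocalization.isDomain_localization P.primeCompl_le_nonZeroDivisors
  have : IsIntegrallyClosed B := hA P
  have : IsNoetherianRing B := IsLocalization.isNoetherianRing P.primeCompl B inferInstance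
  have hcP : c ∈ P := (memP c).2 (dvd_mul_right _ _)
  have hval : ValuationRing B := by
    refine ((tfae_of_isNoetherianRing_of_isLocalRing_of_isDomain B).out 1 4).2 ?_
    by_contra hnp
    -- if `p w = c u` with `u` a unit of `A_P`, then `p` would generate the maximal ideal; so
    -- `w / c` maps the maximal ideal of `A_P` into itself
    have hsub : ∀ p ∈ P, ∀ u, p * w = c * u → u ∈ P := by
      intro p hp u hu
      by_contra huP
      have huP' : u ∈ P.primeCompl := huP
      refine hnp ⟨φ p, le_antisymm ?_ ?_⟩
      · intro x hx
        obtain ⟨q, t, rfl⟩ := IsLocalization.exists_mk'_eq P.primeCompl x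
        have hq : q ∈ P := (IsLocalization.AtPrime.mk'_mem_maximal_iff B P q t).1 hx
        obtain ⟨v, hv⟩ := (memP q).1 hq
        have e : u * q = p * v := mul_left_cancel₀ hc (by linear_combination p * hv - q * hu)
        refine Ideal.mem_span_singleton.2
          ⟨IsLocalization.mk' B v (⟨u, huP'⟩ * t : P.primeCompl), ?_⟩
        refine Eq.trans ?_ (IsLocalization.mul_mk'_eq_mk'_of_mul _ _ _).symm
        rw [← e, IsLocalization.mk'_mul, IsLocalization.mk'_self, one_mul]
      · change Ideal.span {φ p} ≤ _
        rw [Ideal.span_singleton_le_iff_mem]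
        exact (IsLocalization.AtPrime.to_map_mem_maximal_iff B P p).2 hp
    have hdvd : φ c ∣ φ w := by
      refine dvd_of_mul_ideal_le (I := IsLocalRing.maximalIdeal B) ?_ (IsNoetherian.noetherian _)
        ((map_ne_zero_iff _ hinj).2 hc) ?_
      · intro h0
        have := (IsLocalization.AtPrime.to_map_mem_maximal_iff B P c).2 hcP
        rw [h0, Ideal.mem_bot] at this
        exact hc ((map_eq_zero_iff _ hinj).1 this)
      · intro x hx
        obtain ⟨q, t, rfl⟩ := IsLocalization.exists_mk'_eq P.primeCompl x
        have hq : q ∈ P := (IsLocalization.AtPrime.mk'_mem_maximal_iff B P q t).1 hx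
        obtain ⟨v, hv⟩ := (memP q).1 hq
        refine ⟨IsLocalization.mk' B v t,
          (IsLocalization.AtPrime.mk'_mem_maximal_iff B P v t).2 (hsub q hq v hv), ?_⟩
        refine (IsLocalization.mul_mk'_eq_mk'_of_mul _ _ _).trans
          (Eq.trans ?_ (IsLocalization.mul_mk'_eq_mk'_of_mul _ _ _).symm)
        rw [mul_comm w, hv]
    obtain ⟨x, hx⟩ := hdvd
    obtain ⟨r, t, rfl⟩ := IsLocalization.exists_mk'_eq P.primeCompl x
    refine t.2 ((memP t).2 ⟨r, hinj ?_⟩)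
    rw [map_mul, map_mul, hx, mul_comm, mul_assoc, IsLocalization.mk'_spec]
  obtain ⟨s, hs, hsb⟩ := h P hval
  refine hs (hle ?_)
  rw [Submodule.mem_colon_singleton, Submodule.mem_bot]
  exact (Ideal.Quotient.eq_zero_iff_dvd _ _).2 hsb

end

/-! ### Proper birational morphisms over valuation rings -/

section
/-- The zero ideal of the local ring at `x` is the generic point of an irreducible neighbourhood
of `x`, so it lies in every dense open set. -/
lemma genericPoint_fromSpecStalk_mem {X : Scheme.{u}} {W U : X.Opens}
    (hW : IsIrreducible (W : Set X)) (hU : Dense (U : Set X)) {x : X} (hx : x ∈ W)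
    [IsDomain (X.presheaf.stalk x)] :
    X.fromSpecStalk x (⊥ : PrimeSpectrum (X.presheaf.stalk x)) ∈ U := by
  obtain ⟨z, hzU, hzW⟩ := hU.inter_open_nonempty W W.2 hW.1
  have := QuasiSober.sober hW.closure isClosed_closure
  obtain ⟨η, hη⟩ := this
  have hηx : η ⤳ x := by
    rw [specializes_iff_mem_closure, hη.def]
    exact subset_closure hx
  have hηU : η ∈ U := by
    have hηz : η ⤳ z := by
      rw [specializes_iff_mem_closure, hη.def]
      exact subset_closure (by assumption)
    exact hηz.mem_open U.2 (by assumption)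
  obtain ⟨q, hq⟩ : η ∈ Set.range (X.fromSpecStalk x) := by
    rw [Scheme.range_fromSpecStalk]; exact hηx
  have hbq : (⊥ : PrimeSpectrum (X.presheaf.stalk x)) ⤳ q :=
    (PrimeSpectrum.le_iff_specializes _ _).1 bot_le
  refine (hbq.map (X.fromSpecStalk x).continuous).mem_open U.2 ?_
  rw [hq]
  exact hηU

/-- A morphism that is an isomorphism over `U` is a monomorphism over `U`. -/
lemma eq_of_comp_eq_of_mapsTo {T X Y : Scheme.{u}} {f : Y ⟶ X} {U : X.Opens} [IsIso (f ∣_ U)]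
    {a b : T ⟶ Y} (h : a ≫ f = b ≫ f) (ha : ∀ t, f (a t) ∈ U) : a = b := by
  have hb : ∀ t, f (b t) ∈ U := fun t => by
    rw [← Scheme.Hom.comp_apply, ← h]; exact ha t
  have hm : Mono ((f ⁻¹ᵁ U).ι ≫ f) := by
    rw [← morphismRestrict_ι]; infer_instance
  have ea := IsOpenImmersion.lift_fac (f ⁻¹ᵁ U).ι a (by
    rw [Scheme.Opens.range_ι]; rintro _ ⟨t, rfl⟩; exact ha t)
  have eb := IsOpenImmersion.lift_fac (f ⁻¹ᵁ U).ι b (by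
    rw [Scheme.Opens.range_ι]; rintro _ ⟨t, rfl⟩; exact hb t)
  rw [← ea, ← eb]
  congr 1
  rw [← cancel_mono ((f ⁻¹ᵁ U).ι ≫ f), ← Category.assoc, ← Category.assoc, ea, eb, h]

/-- A proper birational morphism is an isomorphism near every point of the target whose local ring
is a valuation ring: the valuative criterion gives a section over the spectrum of the local ring,
which spreads out to a neighbourhood and is inverse to `f` because `f` is separated. -/
lemma exists_isIso_morphismRestrict {X Y : Scheme.{u}} [IsLocallyNoetherian X] [IsReduced Y]
    (f : Y ⟶ X) [IsProper f] (hf : IsBirational f) {W : X.Opens} (hW : IsIrreducible (W : Set X))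
    {x : X} (hx : x ∈ W) [IsDomain (X.presheaf.stalk x)] [ValuationRing (X.presheaf.stalk x)] :
    ∃ U : X.Opens, x ∈ U ∧ IsIso (f ∣_ U) := by
  obtain ⟨U₀, hU₀, hU₀', _⟩ := hf
  let R := X.presheaf.stalk x
  let K := FractionRing R
  let j : Spec (.of K) ⟶ X := Spec.map (CommRingCat.ofHom (algebraMap R K)) ≫ X.fromSpecStalk x
  have hj : Set.range j ⊆ Set.range U₀.ι := by
    rw [Scheme.Opens.range_ι]
    rintro _ ⟨z, rfl⟩
    have hz : Spec.map (CommRingCat.ofHom (algebraMap R K)) z = (⊥ : PrimeSpectrum R) := by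
      have hz0 : z = (⊥ : PrimeSpectrum K) := Subsingleton.elim _ _
      rw [hz0]
      refine PrimeSpectrum.ext ?_
      change Ideal.comap (algebraMap R K) ⊥ = ⊥
      exact Ideal.comap_bot_of_injective _ (IsFractionRing.injective R K)
    have := genericPoint_fromSpecStalk_mem hW hU₀ hx
    rw [Scheme.Hom.comp_apply, hz]
    exact this
  let i₁ : Spec (.of K) ⟶ Y :=
    IsOpenImmersion.lift U₀.ι j hj ≫ inv (f ∣_ U₀) ≫ (f ⁻¹ᵁ U₀).ι
  have hcomm : i₁ ≫ f = j := by
    simp only [i₁, Category.assoc]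
    rw [← morphismRestrict_ι, IsIso.inv_hom_id_assoc, IsOpenImmersion.lift_fac]
  have hex : ValuativeCriterion.Existence f := by
    have : UniversallyClosed f := inferInstance
    rw [UniversallyClosed.eq_valuativeCriterion] at this
    exact this.1
  obtain ⟨⟨l⟩⟩ := hex
    { R := X.presheaf.stalk x, commRing := inferInstance, domain := ‹_›, valuationRing := ‹_›,
      K := K, i₁ := i₁, i₂ := X.fromSpecStalk x, commSq := ⟨hcomm⟩ }
  obtain ⟨U, hxU, σ, -, hσ⟩ := spread_out_of_isGermInjective' (𝟙 X) f (x := x) l.l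
    (by rw [Category.comp_id]; exact l.fac_right)
  rw [Category.comp_id] at hσ
  refine ⟨U, hxU, ?_⟩
  let τ : (U : Scheme.{u}) ⟶ f ⁻¹ᵁ U := IsOpenImmersion.lift (f ⁻¹ᵁ U).ι σ (by
    rw [Scheme.Opens.range_ι]
    rintro _ ⟨z, rfl⟩
    change f (σ z) ∈ U
    rw [← Scheme.Hom.comp_apply, hσ]
    exact z.2)
  have hτ : τ ≫ (f ⁻¹ᵁ U).ι = σ := IsOpenImmersion.lift_fac _ _ _
  have h1 : τ ≫ f ∣_ U = 𝟙 _ := by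
    rw [← cancel_mono U.ι, Category.assoc, morphismRestrict_ι, ← Category.assoc, hτ, hσ,
      Category.id_comp]
  have h2 : f ∣_ U ≫ τ = 𝟙 _ := by
    rw [← cancel_mono (f ⁻¹ᵁ U).ι, Category.assoc, hτ, Category.id_comp]
    let D := (f ⁻¹ᵁ U).ι ⁻¹ᵁ (f ⁻¹ᵁ U₀)
    have hD : IsDominant D.ι := by
      refine ⟨?_⟩
      rw [DenseRange, Scheme.Opens.range_ι]
      exact hU₀'.preimage (f ⁻¹ᵁ U).ι.isOpenEmbedding.isOpenMap
    have hf' : (f ∣_ U ≫ σ) ≫ f = (f ⁻¹ᵁ U).ι ≫ f := by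
      rw [Category.assoc, hσ, morphismRestrict_ι]
    refine ext_of_isDominant_of_isSeparated f hf' D.ι
      (eq_of_comp_eq_of_mapsTo (f := f) (U := U₀) ?_ ?_)
    · rw [Category.assoc, hf', Category.assoc]
    · intro t
      rw [← Scheme.Hom.comp_apply, Category.assoc, hf']
      exact t.2
  exact ⟨τ, h2, h1⟩

end

/-! ### Irreducible open sets and the isomorphism locus -/

section
lemma IsNormal.isReduced {X : Scheme.{u}} (hX : IsNormal X) : IsReduced X := by
  have : ∀ x : X, _root_.IsReduced (X.presheaf.stalk x) := fun x => by
    have := (hX x).1; infer_instance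
  exact isReduced_of_isReduced_stalk X

lemma isIrreducible_of_isDomain {X : Scheme.{u}} {U : X.Opens} (hU : IsAffineOpen U)
    [IsDomain Γ(X, U)] : IsIrreducible (U : Set X) := by
  rw [← hU.range_fromSpec, ← Set.image_univ]
  have : IrreducibleSpace (Spec Γ(X, U)) :=
    inferInstanceAs (IrreducibleSpace (PrimeSpectrum Γ(X, U)))
  exact (IrreducibleSpace.isIrreducible_univ _).image _ hU.fromSpec.continuous.continuousOn

lemma exists_isAffineOpen_isDomain {X : Scheme.{u}} [IsLocallyNoetherian X] (hX : IsNormal X)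
    (x : X) {V : X.Opens} (hV : x ∈ V) :
    ∃ U : X.Opens, IsAffineOpen U ∧ x ∈ U ∧ U ≤ V ∧ IsDomain Γ(X, U) := by
  obtain ⟨U, hxU, hU, hUV, hinj⟩ := X.exists_le_and_germ_injective x V hV
  have := (hX x).1
  exact ⟨U, hU, hxU, hUV, hinj.isDomain (X.presheaf.germ U x hxU).hom⟩

lemma presheaf_map_injective {X : Scheme.{u}} [IsReduced X] {V₀ : X.Opens}
    (hV₀ : IsPreirreducible (V₀ : Set X)) {V' V : X.Opens} (i : V' ⟶ V) (hV : V ≤ V₀)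
    (hV' : (V' : Set X).Nonempty) : Function.Injective (X.presheaf.map i.op) := by
  rw [injective_iff_map_eq_zero]
  intro s hs
  rw [← basicOpen_eq_bot_iff]
  by_contra hne
  obtain ⟨y, hy⟩ : (X.basicOpen s : Set X).Nonempty := by
    rw [Set.nonempty_iff_ne_empty]
    exact fun h => hne (Opens.ext h)
  obtain ⟨y', hy'⟩ := hV'
  obtain ⟨z, -, hz, hz'⟩ := hV₀ _ _ (X.basicOpen s).2 V'.2 ⟨y, hV (X.basicOpen_le s hy), hy⟩
    ⟨y', hV (i.le hy'), hy'⟩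
  have : z ∈ X.basicOpen (X.presheaf.map i.op s) := by
    rw [Scheme.basicOpen_res]; exact ⟨hz', hz⟩
  rw [hs, Scheme.basicOpen_zero] at this
  exact this

section Iso
variable {X Y : Scheme.{u}} {f : Y ⟶ X} {U : X.Opens} [IsIso (f ∣_ U)]

/-- If `f` is an isomorphism over `U`, then the open subsets of `f⁻¹(U)` are preimages. -/
lemma exists_preimage_eq_of_isIso_morphismRestrict {O : Y.Opens} (hO : O ≤ f ⁻¹ᵁ U) :
    ∃ D ≤ U, f ⁻¹ᵁ D = O := by
  let D := U.ι ''ᵁ ((inv (f ∣_ U)) ⁻¹ᵁ ((f ⁻¹ᵁ U).ι ⁻¹ᵁ O))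
  refine ⟨D, ?_, ?_⟩
  · exact (Scheme.Hom.image_le_opensRange _ _).trans (by simp)
  · ext y
    have key : ∀ (h : f y ∈ U), inv (f ∣_ U) ⟨f y, h⟩ = (⟨y, h⟩ : f ⁻¹ᵁ U) := by
      intro h
      have : (⟨f y, h⟩ : U) = (f ∣_ U) (⟨y, h⟩ : f ⁻¹ᵁ U) :=
        Subtype.ext (morphismRestrict_base_coe f U ⟨y, h⟩).symm
      rw [this]
      exact congrArg (fun g : (f ⁻¹ᵁ U : Scheme.{u}) ⟶ f ⁻¹ᵁ U => g (⟨y, h⟩ : f ⁻¹ᵁ U))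
        (IsIso.hom_inv_id (f ∣_ U))
    constructor
    · rintro ⟨z, hz, e⟩
      have h : f y ∈ U := by rw [← e]; exact z.2
      have : z = ⟨f y, h⟩ := Subtype.ext e
      subst this
      change (f ⁻¹ᵁ U).ι (inv (f ∣_ U) ⟨f y, h⟩) ∈ O at hz
      rwa [key] at hz
    · intro hy
      have h : f y ∈ U := hO hy
      refine ⟨⟨f y, h⟩, ?_, rfl⟩
      change (f ⁻¹ᵁ U).ι (inv (f ∣_ U) ⟨f y, h⟩) ∈ O
      rwa [key]

lemma isIso_app_of_isIso_morphismRestrict {D : X.Opens} (hD : D ≤ U) : IsIso (f.app D) := by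
  obtain ⟨D', rfl⟩ : ∃ D', U.ι ''ᵁ D' = D := ⟨U.ι ⁻¹ᵁ D, by
    rw [Scheme.Hom.image_preimage_eq_opensRange_inf, Scheme.Opens.opensRange_ι, inf_eq_right.2 hD]⟩
  have h : IsIso ((f ∣_ U).app D') := inferInstance
  rw [morphismRestrict_app] at h
  have h' : IsIso (Y.presheaf.map (eqToHom (image_morphismRestrict_preimage f U D')).op) :=
    inferInstance
  exact @IsIso.of_isIso_comp_right _ _ _ _ _ _ _ h' h

lemma exists_mem_of_isIso_morphismRestrict {x : X} (hx : x ∈ U) : ∃ y, f y = x := by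
  refine ⟨(inv (f ∣_ U) ⟨x, hx⟩ : f ⁻¹ᵁ U).1, ?_⟩
  rw [← morphismRestrict_base_coe]
  exact congrArg Subtype.val (congrArg (fun g : (U : Scheme.{u}) ⟶ U => g (⟨x, hx⟩ : U))
    (IsIso.inv_hom_id (f ∣_ U)))

lemma eq_of_isIso_morphismRestrict {y y' : Y} (hy : f y ∈ U) (h : f y = f y') : y = y' := by
  have hy' : f y' ∈ U := h ▸ hy
  have : (f ∣_ U) (⟨y, hy⟩ : f ⁻¹ᵁ U) = (f ∣_ U) (⟨y', hy'⟩ : f ⁻¹ᵁ U) :=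
    Subtype.ext ((morphismRestrict_base_coe f U ⟨y, hy⟩).trans
      (h.trans (morphismRestrict_base_coe f U ⟨y', hy'⟩).symm))
  exact congrArg Subtype.val ((f ∣_ U).isOpenEmbedding.injective this)

lemma notMem_exceptionalLocus {y : Y} (hy : f y ∈ U) : y ∉ exceptionalLocus f := by
  simp only [exceptionalLocus, Set.mem_ofPred_eq, not_not]
  refine ⟨f ⁻¹ᵁ U, hy, ?_⟩
  rw [← morphismRestrict_ι]
  infer_instance
end Iso

lemma exceptionalDivisor_subset {X Y : Scheme.{u}} (f : Y ⟶ X) :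
    (exceptionalDivisor f : Set Y) ⊆ exceptionalLocus f := by
  refine closure_minimal (fun y hy => hy.1) ?_
  rw [← isOpen_compl_iff, isOpen_iff_forall_mem_open]
  intro y hy
  simp only [exceptionalLocus, Set.mem_compl_iff, Set.mem_ofPred_eq, not_not] at hy
  obtain ⟨U, hU, h⟩ := hy
  exact ⟨U, fun z hz => by
    simp only [exceptionalLocus, Set.mem_compl_iff, Set.mem_ofPred_eq, not_not]
    exact ⟨U, hz, h⟩, U.2, hU⟩

lemma isPreirreducible_preimage {X Y : Scheme.{u}} {f : Y ⟶ X} (hf : IsBirational f) {W : X.Opens}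
    (hW : IsPreirreducible (W : Set X)) : IsPreirreducible ((f ⁻¹ᵁ W : Y.Opens) : Set Y) := by
  obtain ⟨U₀, hU₀, hU₀', _⟩ := hf
  have key : ∀ O : Set Y, IsOpen O → (((f ⁻¹ᵁ W : Y.Opens) : Set Y) ∩ O).Nonempty →
      ∃ D ≤ U₀, (D : Set X).Nonempty ∧ D ≤ W ∧ (f ⁻¹ᵁ D : Set Y) ⊆ O := by
    intro O hO hne
    obtain ⟨y, ⟨hyW, hyO⟩, hyU⟩ := hU₀'.inter_open_nonempty _ ((f ⁻¹ᵁ W).2.inter hO) hne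
    obtain ⟨D, hDU, hD⟩ := exists_preimage_eq_of_isIso_morphismRestrict (f := f) (U := U₀)
      (O := f ⁻¹ᵁ U₀ ⊓ (f ⁻¹ᵁ W ⊓ ⟨O, hO⟩)) inf_le_left
    have hmem : ∀ y, y ∈ f ⁻¹ᵁ D ↔ (f y ∈ U₀ ∧ f y ∈ W ∧ y ∈ O) := fun y => by rw [hD]; rfl
    refine ⟨D, hDU, ⟨f y, (hmem y).2 ⟨hyU, hyW, hyO⟩⟩, ?_, fun y hy => ((hmem y).1 hy).2.2⟩
    intro x hx
    obtain ⟨y, rfl⟩ := exists_mem_of_isIso_morphismRestrict (f := f) (hDU hx)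
    exact ((hmem y).1 hx).2.1
  intro O₁ O₂ h₁ h₂ n₁ n₂
  obtain ⟨D₁, hD₁U, ⟨x₁, hx₁⟩, hD₁W, hD₁⟩ := key O₁ h₁ n₁
  obtain ⟨D₂, hD₂U, ⟨x₂, hx₂⟩, hD₂W, hD₂⟩ := key O₂ h₂ n₂
  obtain ⟨x, hxW, hx1, hx2⟩ := hW _ _ D₁.2 D₂.2 ⟨x₁, hD₁W hx₁, hx₁⟩ ⟨x₂, hD₂W hx₂, hx₂⟩
  obtain ⟨y, rfl⟩ := exists_mem_of_isIso_morphismRestrict (f := f) (hD₁U hx1)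
  exact ⟨y, hxW, hD₁ hx1, hD₂ hx2⟩

end

/-! ### Functions on open subsets of the source -/

section
lemma map_appLE_apply {X Y : Scheme.{u}} (f : Y ⟶ X) {W : X.Opens} {V V' : Y.Opens}
    (e : V ≤ f ⁻¹ᵁ W) (i : V' ⟶ V) (a : Γ(X, W)) :
    Y.presheaf.map i.op (f.appLE W V e a) = f.appLE W V' (i.le.trans e) a := by
  rw [← ConcreteCategory.comp_apply, Scheme.Hom.appLE_map]

lemma appLE_map_apply {X Y : Scheme.{u}} (f : Y ⟶ X) {W W' : X.Opens} {V : Y.Opens}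
    (i : W' ⟶ W) (e : V ≤ f ⁻¹ᵁ W') (a : Γ(X, W)) :
    f.appLE W' V e (X.presheaf.map i.op a) = f.appLE W V (e.trans (f.preimage_mono i.le)) a := by
  rw [← ConcreteCategory.comp_apply, Scheme.Hom.map_appLE]

/-- Over a point `x` near which `f` is an isomorphism, a function near the fibre of `x` is a
fraction of functions on `W` whose denominator does not vanish at `x`. -/
lemma exists_mul_eq_appLE {X Y : Scheme.{u}} [IsReduced Y] {f : Y ⟶ X} {W : X.Opens}
    (hW : IsAffineOpen W) (hV₀ : IsPreirreducible ((f ⁻¹ᵁ W : Y.Opens) : Set Y))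
    {U : X.Opens} [IsIso (f ∣_ U)] {x : X} (hxU : x ∈ U) (hxW : x ∈ W) {V : Y.Opens}
    (hV : V ≤ f ⁻¹ᵁ W) (hxV : ∀ y, f y = x → y ∈ V) (z : Γ(Y, V)) :
    ∃ h a : Γ(X, W), x ∈ X.basicOpen h ∧ f.appLE W V hV h * z = f.appLE W V hV a := by
  obtain ⟨D, hDU, hD⟩ := exists_preimage_eq_of_isIso_morphismRestrict (f := f) (U := U)
    (O := f ⁻¹ᵁ U ⊓ V) inf_le_left
  obtain ⟨y, rfl⟩ := exists_mem_of_isIso_morphismRestrict (f := f) hxU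
  have hyD : y ∈ f ⁻¹ᵁ D := by rw [hD]; exact ⟨hxU, hxV y rfl⟩
  obtain ⟨h, hhD, hxh⟩ := hW.exists_basicOpen_le ⟨f y, hyD⟩ hxW
  let B := X.basicOpen h
  have hBV : f ⁻¹ᵁ B ≤ V := (f.preimage_mono hhD).trans (hD.le.trans inf_le_right)
  have hiso : IsIso (f.app B) := isIso_app_of_isIso_morphismRestrict (hhD.trans hDU)
  obtain ⟨w, hw⟩ := (ConcreteCategory.bijective_of_isIso (f.app B)).2
    (Y.presheaf.map (homOfLE hBV).op z)
  have hloc := hW.isLocalization_basicOpen h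
  obtain ⟨⟨a, ⟨_, n, rfl⟩⟩, ha⟩ := IsLocalization.surj (Submonoid.powers h) w
  refine ⟨h ^ n, a, ?_, ?_⟩
  · rw [Scheme.mem_basicOpen _ _ _ hxW] at hxh ⊢
    rw [map_pow]
    exact hxh.pow n
  · apply presheaf_map_injective hV₀ (homOfLE hBV) hV ⟨y, hxh⟩
    rw [map_mul, map_appLE_apply, map_appLE_apply, ← hw]
    have e := congrArg (f.app B) ha
    rw [map_mul, mul_comm] at e
    have hBW : B ≤ W := X.basicOpen_le h
    have key : ∀ b : Γ(X, W), f.app B (algebraMap Γ(X, W) Γ(X, B) b) =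
        f.appLE W (f ⁻¹ᵁ B) (f.preimage_mono hBW) b := by
      intro b
      change f.app B (X.presheaf.map (homOfLE hBW).op b) = _
      rw [← appLE_map_apply f (homOfLE hBW) le_rfl, Scheme.Hom.appLE_eq_app]
    rw [key, key] at e
    exact e

lemma appLE_injective {X Y : Scheme.{u}} [IsReduced X] [IsReduced Y] {f : Y ⟶ X}
    (hf : IsBirational f) {W : X.Opens} (hW : IsPreirreducible (W : Set X)) {V : Y.Opens}
    (hV : V ≤ f ⁻¹ᵁ W) (hne : (V : Set Y).Nonempty) : Function.Injective (f.appLE W V hV) := by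
  obtain ⟨U₀, hU₀, hU₀', _⟩ := hf
  obtain ⟨y, hy, hyU⟩ := hU₀'.inter_open_nonempty _ V.2 hne
  obtain ⟨D, hDU, hD⟩ := exists_preimage_eq_of_isIso_morphismRestrict (f := f) (U := U₀)
    (O := f ⁻¹ᵁ U₀ ⊓ V) inf_le_left
  have hyD : y ∈ f ⁻¹ᵁ D := by rw [hD]; exact ⟨hyU, hy⟩
  have hDW : D ≤ W := fun x hx => by
    obtain ⟨y, rfl⟩ := exists_mem_of_isIso_morphismRestrict (f := f) (hDU hx)
    exact hV ((hD.le.trans inf_le_right) hx)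
  have hiso : IsIso (f.app D) := isIso_app_of_isIso_morphismRestrict hDU
  have h1 : Function.Injective (f.app D ∘ X.presheaf.map (homOfLE hDW).op) :=
    (ConcreteCategory.bijective_of_isIso (f.app D)).1.comp
      (presheaf_map_injective hW (homOfLE hDW) le_rfl ⟨f y, hyD⟩)
  have h2 : (f.app D ∘ X.presheaf.map (homOfLE hDW).op) =
      Y.presheaf.map (homOfLE (hD.le.trans inf_le_right)).op ∘ f.appLE W V hV := by
    funext a
    simp only [Function.comp_apply]
    rw [map_appLE_apply, ← Scheme.Hom.appLE_eq_app, appLE_map_apply]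
  rw [h2] at h1
  exact h1.of_comp

/-- A function on an open piece `V` of `f⁻¹(W)` comes from `W` if, over each point of `W` near which
`f` is an isomorphism, it agrees with a function that is regular near the fibre. These points
include those of codimension one, so normality applies. -/
lemma exists_eq_appLE {X Y : Scheme.{u}} [IsLocallyNoetherian X] [IsReduced Y] (hX : IsNormal X)
    (f : Y ⟶ X) [IsProper f] (hf : IsBirational f) {W : X.Opens} (hW : IsAffineOpen W)
    [IsDomain Γ(X, W)] {V : Y.Opens} (hV : V ≤ f ⁻¹ᵁ W) (hne : (V : Set Y).Nonempty) (z : Γ(Y, V))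
    (hz : ∀ x ∈ W, ∀ U : X.Opens, x ∈ U → IsIso (f ∣_ U) →
      ∃ V' ≤ f ⁻¹ᵁ W, (∀ y, f y = x → y ∈ V') ∧ ∃ z' : Γ(Y, V'),
        Y.presheaf.map (homOfLE (inf_le_left : V ⊓ V' ≤ V)).op z =
          Y.presheaf.map (homOfLE (inf_le_right : V ⊓ V' ≤ V')).op z') :
    ∃ a : Γ(X, W), z = f.appLE W V hV a := by
  have := hX.isReduced
  have hWirr := isIrreducible_of_isDomain hW
  have hV₀ := isPreirreducible_preimage hf hWirr.2
  have local_eq : ∀ x ∈ W, ∀ U : X.Opens, x ∈ U → IsIso (f ∣_ U) → ∃ h a : Γ(X, W),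
      x ∈ X.basicOpen h ∧ f.appLE W V hV h * z = f.appLE W V hV a := by
    intro x hxW U hxU hU
    obtain ⟨V', hV', hxV', z', hz'⟩ := hz x hxW U hxU hU
    obtain ⟨h, a, hxh, e⟩ := exists_mul_eq_appLE hW hV₀ hxU hxW hV' hxV' z'
    refine ⟨h, a, hxh, ?_⟩
    obtain ⟨y, rfl⟩ := exists_mem_of_isIso_morphismRestrict (f := f) hxU
    obtain ⟨v, hv⟩ := hne
    obtain ⟨t, -, ht, ht'⟩ := hV₀ _ _ V.2 V'.2 ⟨v, hV hv, hv⟩ ⟨y, hV' (hxV' y rfl), hxV' y rfl⟩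
    apply presheaf_map_injective hV₀ (homOfLE (inf_le_left : V ⊓ V' ≤ V)) hV ⟨t, ht, ht'⟩
    rw [map_mul, map_appLE_apply, map_appLE_apply, hz']
    have e' := congrArg (Y.presheaf.map (homOfLE (inf_le_right : V ⊓ V' ≤ V')).op) e
    rwa [map_mul, map_appLE_apply, map_appLE_apply] at e'
  -- `z` is the fraction `b / c`; it remains to see that `c` divides `b`
  obtain ⟨c, b, hc, e⟩ : ∃ c b : Γ(X, W), c ≠ 0 ∧ f.appLE W V hV c * z = f.appLE W V hV b := by
    obtain ⟨U₀, hU₀, hU₀', hiso⟩ := hf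
    obtain ⟨x, hxW, hxU⟩ := hU₀.inter_open_nonempty _ W.2 hWirr.1
    obtain ⟨c, b, hxc, e⟩ := local_eq x hxW U₀ hxU hiso
    refine ⟨c, b, ?_, e⟩
    rintro rfl
    rw [Scheme.basicOpen_zero] at hxc
    exact hxc
  have hinj := appLE_injective hf hWirr.2 hV hne
  have : IsNoetherianRing Γ(X, W) := IsLocallyNoetherian.component_noetherian ⟨W, hW⟩
  have hdvd : c ∣ b := by
    have hstalk : ∀ (P : Ideal Γ(X, W)) [P.IsPrime], ∃ x : X, ∃ hx : x ∈ W,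
        Nonempty (Localization.AtPrime P ≃+* X.presheaf.stalk x) ∧
        ∀ h : Γ(X, W), x ∈ X.basicOpen h → h ∉ P := by
      intro P hP
      let y : PrimeSpectrum Γ(X, W) := ⟨P, hP⟩
      have hy : hW.fromSpec y ∈ W := by
        have : hW.fromSpec y ∈ Set.range hW.fromSpec := ⟨y, rfl⟩
        rwa [hW.range_fromSpec] at this
      let := TopCat.Presheaf.algebra_section_stalk X.presheaf ⟨hW.fromSpec y, hy⟩
      have hloc : IsLocalization.AtPrime (X.presheaf.stalk (hW.fromSpec y)) P :=
        hW.isLocalization_stalk' y hy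
      refine ⟨hW.fromSpec y, hy, ⟨(IsLocalization.algEquiv P.primeCompl
        (Localization.AtPrime P) (X.presheaf.stalk (hW.fromSpec y))).toRingEquiv⟩, ?_⟩
      intro h hh
      rw [Scheme.mem_basicOpen _ _ _ hy] at hh
      exact (IsLocalization.AtPrime.isUnit_to_map_iff
        (X.presheaf.stalk (hW.fromSpec y)) P h).1 hh
    refine dvd_of_forall_valuationRing ?_ hc ?_
    · intro P _
      obtain ⟨x, -, ⟨e⟩, -⟩ := hstalk P
      have := (hX x).2
      exact IsIntegrallyClosed.of_equiv e.symm
    · intro P _ hPv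
      obtain ⟨x, hxW, ⟨e'⟩, hxP⟩ := hstalk P
      have := (hX x).1
      have : ValuationRing (X.presheaf.stalk x) :=
        Function.Surjective.valuationRing e'.toRingHom e'.surjective
      obtain ⟨U, hxU, hU⟩ := exists_isIso_morphismRestrict f hf hWirr hxW
      obtain ⟨h, a, hxh, e''⟩ := local_eq x hxW U hxU hU
      refine ⟨h, hxP h hxh, a, hinj ?_⟩
      rw [map_mul, map_mul, ← e, ← e'']
      ring
  obtain ⟨a, rfl⟩ := hdvd
  refine ⟨a, ?_⟩
  have hD : ((Y.basicOpen (f.appLE W V hV c) : Y.Opens) : Set Y).Nonempty := by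
    rw [Set.nonempty_iff_ne_empty]
    intro h0
    have : Y.basicOpen (f.appLE W V hV c) = ⊥ := Opens.ext h0
    rw [basicOpen_eq_bot_iff, map_eq_zero_iff _ hinj] at this
    exact hc this
  apply presheaf_map_injective hV₀ (homOfLE (Y.basicOpen_le (f.appLE W V hV c))) hV hD
  have hu := RingedSpace.isUnit_res_basicOpen Y.toRingedSpace (f.appLE W V hV c)
  rw [map_mul] at e
  have e' := congrArg (Y.presheaf.map (homOfLE (Y.basicOpen_le (f.appLE W V hV c))).op) e
  rw [map_mul, map_mul] at e'
  exact hu.mul_left_cancel e'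

end

/-! ### Sections of sheaves of homomorphisms -/

section
/-- Restriction of functions. -/
def fres {Y : Scheme.{u}} {V U : Y.Opens} (h : V ≤ U) : Γ(Y, U) →+* Γ(Y, V) :=
  (Y.presheaf.map (homOfLE h).op).hom

/-- Restriction of sections of a presheaf of modules, as a semilinear map. -/
def res {Y : Scheme.{u}} (P : Y.PresheafOfModules) {V U : Y.Opens} (h : V ≤ U) :
    P.presheaf.obj (op U) →ₛₗ[fres h] P.presheaf.obj (op V) where
  toFun := P.presheaf.map (homOfLE h).op
  map_add' := map_add _
  map_smul' r x := presheaf_map_smul P (homOfLE h) r x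

variable {Y : Scheme.{u}}

lemma fres_fres {V W U : Y.Opens} (h : V ≤ W) (h' : W ≤ U) (s : Γ(Y, U)) :
    fres h (fres h' s) = fres (h.trans h') s := by
  simp only [fres, ← CommRingCat.comp_apply, ← Functor.map_comp]
  rfl

lemma fres_self {U : Y.Opens} (h : U ≤ U) (s : Γ(Y, U)) : fres h s = s := by
  have : (homOfLE h).op = 𝟙 (op U) := rfl
  simp only [fres, this, CategoryTheory.Functor.map_id]
  rfl

lemma res_res (P : Y.PresheafOfModules) {V W U : Y.Opens} (h : V ≤ W) (h' : W ≤ U)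
    (s : P.presheaf.obj (op U)) : res P h (res P h' s) = res P (h.trans h') s := by
  change P.presheaf.map _ (P.presheaf.map _ s) = P.presheaf.map _ s
  rw [← ConcreteCategory.comp_apply, ← Functor.map_comp]
  rfl

lemma res_self (P : Y.PresheafOfModules) {U : Y.Opens} (h : U ≤ U)
    (s : P.presheaf.obj (op U)) : res P h s = s := by
  have : (homOfLE h).op = 𝟙 (op U) := rfl
  change P.presheaf.map _ s = s
  rw [this, CategoryTheory.Functor.map_id]
  rfl

lemma eq_of_locally_res_eq (N : Y.Modules) {V : Y.Opens} {s t : N.val.presheaf.obj (op V)}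
    (h : ∀ y ∈ V, ∃ (V' : Y.Opens) (hV' : V' ≤ V), y ∈ V' ∧ res N.val hV' s = res N.val hV' t) :
    s = t := by
  let NS : TopCat.Sheaf Ab.{u} Y := ⟨N.presheaf, N.isSheaf⟩
  choose V' hV' hy h using h
  refine NS.eq_of_locally_eq' (fun y : V => V' y y.2) V (fun y => homOfLE (hV' y y.2)) ?_ s t
    (fun y => h y y.2)
  intro y hyV
  exact Opens.mem_iSup.mpr ⟨⟨y, hyV⟩, hy y hyV⟩

lemma exists_glue (N : Y.Modules) {V : Y.Opens} {ι : Type*} (V' : ι → Y.Opens) (hV' : ∀ i, V' i ≤ V)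
    (hcov : ∀ y ∈ V, ∃ i, y ∈ V' i) (s : ∀ i, N.val.presheaf.obj (op (V' i)))
    (h : ∀ i j, res N.val inf_le_left (s i) =
      res N.val (inf_le_right : V' i ⊓ V' j ≤ V' j) (s j)) :
    ∃ t : N.val.presheaf.obj (op V), ∀ i, res N.val (hV' i) t = s i := by
  let NS : TopCat.Sheaf Ab.{u} Y := ⟨N.presheaf, N.isSheaf⟩
  obtain ⟨t, ht, -⟩ := NS.existsUnique_gluing' V' V (fun i => homOfLE (hV' i))
    (fun y hy => Opens.mem_iSup.mpr (hcov y hy)) s (fun i j => h i j)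
  exact ⟨t, ht⟩

/-- The linear map on sections over `V ≤ W` given by a section over `W` of `ℋom(P, N)`. -/
def homApp {P : Y.PresheafOfModules} {N : Y.Modules} {W V : Y.Opens} (φ : homSections P N W)
    (hV : V ≤ W) : P.presheaf.obj (op V) →ₗ[Γ(Y, V)] N.val.presheaf.obj (op V) :=
  φ.1 ⟨V, hV⟩

lemma homApp_res {P : Y.PresheafOfModules} {N : Y.Modules} {W V V' : Y.Opens}
    (φ : homSections P N W) (hV : V ≤ W) (h : V' ≤ V) (x : P.presheaf.obj (op V)) :
    homApp φ (h.trans hV) (res P h x) = res N.val h (homApp φ hV x) :=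
  φ.2 ⟨V, hV⟩ ⟨V', h.trans hV⟩ (homOfLE h) x

/-- A single-valued, linear and local relation that is locally solvable is the graph of a section of
`ℋom(P, N)`. -/
lemma exists_homSections_of_rel (P : Y.PresheafOfModules) (N : Y.Modules) {U : Y.Opens}
    (R : ∀ V ≤ U, P.presheaf.obj (op V) → N.val.presheaf.obj (op V) → Prop)
    (huniq : ∀ V hV p r r', R V hV p r → R V hV p r' → r = r')
    (hadd : ∀ V hV p p' r r', R V hV p r → R V hV p' r' → R V hV (p + p') (r + r'))
    (hsmul : ∀ V hV (c : Γ(Y, V)) p r, R V hV p r → R V hV (c • p) (c • r))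
    (hres : ∀ V hV V' (h : V' ≤ V) p r, R V hV p r → R V' (h.trans hV) (res P h p) (res N.val h r))
    (hloc : ∀ V hV p r, (∀ y ∈ V, ∃ (V' : Y.Opens) (h : V' ≤ V), y ∈ V' ∧
      R V' (h.trans hV) (res P h p) (res N.val h r)) → R V hV p r)
    (hex : ∀ V (hV : V ≤ U) p, ∀ y ∈ V, ∃ (V' : Y.Opens) (h : V' ≤ V), y ∈ V' ∧
      ∃ r, R V' (h.trans hV) (res P h p) r) :
    ∃ ψ : homSections P N U, ∀ V (hV : V ≤ U) p, R V hV p (homApp ψ hV p) := by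
  have hex' : ∀ V (hV : V ≤ U) p, ∃ r, R V hV p r := by
    intro V hV p
    choose V' h hy r hr using hex V hV p
    obtain ⟨t, ht⟩ := exists_glue N (fun y : V => V' y y.2) (fun y => h y y.2)
      (fun y hyV => ⟨⟨y, hyV⟩, hy y hyV⟩) (fun y => r y y.2) (fun i j => by
        have h1 := hres _ _ _ (inf_le_left : V' i i.2 ⊓ V' j j.2 ≤ _) _ _ (hr i i.2)
        have h2 := hres _ _ _ (inf_le_right : V' i i.2 ⊓ V' j j.2 ≤ _) _ _ (hr j j.2)
        rw [res_res] at h1 h2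
        exact huniq _ _ _ _ _ h1 h2)
    refine ⟨t, hloc _ _ _ _ fun y hyV => ⟨V' y hyV, h y hyV, hy y hyV, ?_⟩⟩
    rw [ht ⟨y, hyV⟩]
    exact hr y hyV
  choose g hg using hex'
  refine ⟨⟨fun V =>
    { toFun := g V.1 V.2
      map_add' := fun p p' => huniq _ _ _ _ _ (hg _ _ _) (hadd _ _ _ _ _ _ (hg _ _ _) (hg _ _ _))
      map_smul' := fun c p => huniq _ _ _ _ _ (hg _ _ _) (hsmul _ _ _ _ _ (hg _ _ _)) }, ?_⟩, hg⟩
  intro V V' i x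
  exact huniq _ _ _ _ _ (hg _ _ _) (hres _ _ _ i.le _ _ (hg V.1 V.2 x))

/-- A homomorphism `φ` over `D` extends to `U` if sections of `N` are determined by their
restrictions to `D` and each value of `φ` extends locally. -/
lemma exists_homSections_extend {P : Y.PresheafOfModules} {N : Y.Modules} {D U : Y.Opens}
    (hinj : ∀ V ≤ U, Function.Injective (res N.val (inf_le_left : V ⊓ D ≤ V)))
    (φ : homSections P N D)
    (hex : ∀ V ≤ U, ∀ p : P.presheaf.obj (op V), ∀ y ∈ V, ∃ (V' : Y.Opens) (h : V' ≤ V), y ∈ V' ∧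
      ∃ r : N.val.presheaf.obj (op V'), res N.val (inf_le_left : V' ⊓ D ≤ V') r =
        homApp φ inf_le_right (res P (inf_le_left.trans h) p)) :
    ∃ ψ : homSections P N U, ∀ V (hVU : V ≤ U) (hVD : V ≤ D) p,
      homApp ψ hVU p = homApp φ hVD p := by
  obtain ⟨ψ, hψ⟩ := exists_homSections_of_rel P N (U := U)
    (fun V _ p r => res N.val (inf_le_left : V ⊓ D ≤ V) r =
      homApp φ inf_le_right (res P inf_le_left p))
    (fun V hV p r r' h h' => hinj V hV (h.trans h'.symm))
    (fun V hV p p' r r' h h' => by rw [map_add, h, h', map_add, map_add])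
    (fun V hV c p r h => by rw [map_smulₛₗ, h, map_smulₛₗ, map_smulₛₗ]; rfl)
    (fun V hV V' h p r e => by
      rw [res_res, res_res]
      have e' := congrArg (res N.val (inf_le_inf_right D h)) e
      rw [res_res, ← homApp_res, res_res] at e'
      exact e')
    (fun V hV p r e => by
      refine eq_of_locally_res_eq N fun y hy => ?_
      obtain ⟨V', h, hyV', e'⟩ := e y hy.1
      refine ⟨V' ⊓ D, inf_le_inf_right D h, ⟨hyV', hy.2⟩, ?_⟩
      rw [res_res, res_res] at e'
      rw [res_res, ← homApp_res, res_res]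
      exact e')
    (fun V hV p y hy => by
      obtain ⟨V', h, hy', r, hr⟩ := hex V hV p y hy
      exact ⟨V', h, hy', r, by rw [res_res]; exact hr⟩)
  refine ⟨ψ, fun V hVU hVD p => ?_⟩
  have e := hψ V hVU p
  rw [homApp_res φ hVD] at e
  have hV : V ≤ V ⊓ D := le_inf le_rfl hVD
  have e' := congrArg (res N.val hV) e
  rwa [res_res, res_res, res_self, res_self] at e'

end

/-! ### Finitely generated and torsionless presheaves of modules -/

section
variable {Y : Scheme.{u}}

/-- The sections `e i` over `U` generate the presheaf `P` locally on `U`. -/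
def Generates (P : Y.PresheafOfModules) {U : Y.Opens} {ι : Type} (e : ι → P.presheaf.obj (op U)) :
    Prop :=
  ∀ (V : Y.Opens) (hV : V ≤ U) (p : P.presheaf.obj (op V)), ∀ y ∈ V,
    ∃ (V' : Y.Opens) (h : V' ≤ V), y ∈ V' ∧
      res P h p ∈ Submodule.span Γ(Y, V') (Set.range fun i => res P (h.trans hV) (e i))

/-- `P` is generated over `U`, locally on `U`, by finitely many sections over `U`. -/
def FinGen (P : Y.PresheafOfModules) (U : Y.Opens) : Prop :=
  ∃ (ι : Type) (_ : Finite ι) (e : ι → P.presheaf.obj (op U)), Generates P e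

/-- The structure sheaf as a module over itself. -/
abbrev structureSheaf (Y : Scheme.{u}) : Y.Modules := SheafOfModules.unit Y.ringCatSheaf

/-- The value of a local functional `P|_W ⟶ 𝒪_W` on a section over `V ≤ W`, as a function. -/
def evalApp {P : Y.PresheafOfModules} {W V : Y.Opens} (φ : homSections P (structureSheaf Y) W)
    (hV : V ≤ W) : P.presheaf.obj (op V) →ₗ[Γ(Y, V)] Γ(Y, V) where
  toFun x := homApp φ hV x
  map_add' := map_add (homApp φ hV)
  map_smul' := map_smul (homApp φ hV)

lemma evalApp_res {P : Y.PresheafOfModules} {W V V' : Y.Opens}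
    (φ : homSections P (structureSheaf Y) W) (hV : V ≤ W) (h : V' ≤ V) (x : P.presheaf.obj (op V)) :
    evalApp φ (h.trans hV) (res P h x) = fres h (evalApp φ hV x) :=
  homApp_res φ hV h x

/-- `P` is torsionless over `U`: finitely many functionals `P|_U ⟶ 𝒪_U` separate the sections of
`P` over open subsets of `U`. -/
def Torsionless (P : Y.PresheafOfModules) (U : Y.Opens) : Prop :=
  ∃ (κ : Type) (_ : Finite κ) (φ : κ → homSections P (structureSheaf Y) U),
    ∀ (V : Y.Opens) (hV : V ≤ U) (x : P.presheaf.obj (op V)),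
      (∀ k, evalApp (φ k) hV x = 0) → x = 0

lemma res_mem_span {P : Y.PresheafOfModules} {V V' : Y.Opens} (h : V' ≤ V) {ι : Type}
    {s : ι → P.presheaf.obj (op V)} {x} (hx : x ∈ Submodule.span Γ(Y, V) (Set.range s)) :
    res P h x ∈ Submodule.span Γ(Y, V') (Set.range fun i => res P h (s i)) := by
  induction hx using Submodule.span_induction with
  | mem x hx => obtain ⟨i, rfl⟩ := hx; exact Submodule.subset_span ⟨i, rfl⟩
  | zero => rw [map_zero]; exact zero_mem _
  | add x y _ _ hx hy => rw [map_add]; exact add_mem hx hy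
  | smul c x _ hx => rw [map_smulₛₗ]; exact Submodule.smul_mem _ _ hx

lemma Generates.res {P : Y.PresheafOfModules} {U : Y.Opens} {ι : Type}
    {e : ι → P.presheaf.obj (op U)} (he : Generates P e) {U' : Y.Opens} (h : U' ≤ U) :
    Generates P (fun i => res P h (e i)) := by
  intro V hV p y hy
  obtain ⟨V', hV', hy', hp⟩ := he V (hV.trans h) p y hy
  refine ⟨V', hV', hy', ?_⟩
  simpa only [res_res] using hp

lemma FinGen.mono {P : Y.PresheafOfModules} {U U' : Y.Opens} (hP : FinGen P U) (h : U' ≤ U) :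
    FinGen P U' := by
  obtain ⟨ι, hι, e, he⟩ := hP
  exact ⟨ι, hι, _, he.res h⟩

/-- Restriction of sections of `ℋom(P, N)`. -/
def homRes {P : Y.PresheafOfModules} {N : Y.Modules} {W W' : Y.Opens} (h : W' ≤ W)
    (φ : homSections P N W) : homSections P N W' :=
  ⟨fun V => φ.1 ⟨V.1, V.2.trans h⟩, fun V V' i x => φ.2 ⟨V.1, _⟩ ⟨V'.1, _⟩ i x⟩

lemma Torsionless.mono {P : Y.PresheafOfModules} {U U' : Y.Opens} (hP : Torsionless P U)
    (h : U' ≤ U) : Torsionless P U' := by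
  obtain ⟨κ, hκ, φ, hφ⟩ := hP
  exact ⟨κ, hκ, fun k => homRes h (φ k), fun V hV x hx => hφ V (hV.trans h) x hx⟩

/-- A section of the dual as a family of functionals. -/
def ofDual {P : Y.PresheafOfModules} {W : Y.Opens} (q : (dual P).val.presheaf.obj (op W)) :
    homSections P (structureSheaf Y) W := q

/-- A family of functionals as a section of the dual. -/
def toDual {P : Y.PresheafOfModules} {W : Y.Opens} (q : homSections P (structureSheaf Y) W) :
    (dual P).val.presheaf.obj (op W) := q

/-- The pairing of a section over `W` of the dual of `P` with a section of `P` over `V ≤ W`. -/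
def pairing (P : Y.PresheafOfModules) {W V : Y.Opens} (hV : V ≤ W) (x : P.presheaf.obj (op V)) :
    (dual P).val.presheaf.obj (op W) →ₛₗ[fres hV] Γ(Y, V) where
  toFun q := evalApp (ofDual q) hV x
  map_add' _ _ := rfl
  map_smul' _ _ := rfl

lemma pairing_res_left {P : Y.PresheafOfModules} {W W' V : Y.Opens} (hW : W' ≤ W) (hV : V ≤ W')
    (x : P.presheaf.obj (op V)) (q : (dual P).val.presheaf.obj (op W)) :
    pairing P hV x (res (dual P).val hW q) = pairing P (hV.trans hW) x q := rfl

lemma pairing_res_right {P : Y.PresheafOfModules} {W V V' : Y.Opens} (hV : V ≤ W) (h : V' ≤ V)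
    (x : P.presheaf.obj (op V)) (q : (dual P).val.presheaf.obj (op W)) :
    pairing P (h.trans hV) (res P h x) q = fres h (pairing P hV x q) :=
  evalApp_res _ hV h x

lemma dual_ext {P : Y.PresheafOfModules} {W : Y.Opens} {q q' : (dual P).val.presheaf.obj (op W)}
    (h : ∀ (V : Y.Opens) (hV : V ≤ W) (x : P.presheaf.obj (op V)),
      pairing P hV x q = pairing P hV x q') : q = q' :=
  by
  refine Subtype.ext (funext fun V => ?_)
  exact DFunLike.ext _ _ fun x => h V.1 V.2 x

lemma fun_eq_of_locally {V : Y.Opens} {s t : Γ(Y, V)}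
    (h : ∀ y ∈ V, ∃ (V' : Y.Opens) (hV' : V' ≤ V), y ∈ V' ∧ fres hV' s = fres hV' t) : s = t :=
  eq_of_locally_res_eq (structureSheaf Y) h

lemma pairing_smul (P : Y.PresheafOfModules) {W V : Y.Opens} (hV : V ≤ W) (c : Γ(Y, V))
    (x : P.presheaf.obj (op V)) (q : (dual P).val.presheaf.obj (op W)) :
    pairing P hV (c • x) q = c * pairing P hV x q :=
  map_smul (evalApp (ofDual q) hV) c x

lemma pairing_add (P : Y.PresheafOfModules) {W V : Y.Opens} (hV : V ≤ W)
    (x x' : P.presheaf.obj (op V)) (q : (dual P).val.presheaf.obj (op W)) :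
    pairing P hV (x + x') q = pairing P hV x q + pairing P hV x' q :=
  map_add (evalApp (ofDual q) hV) x x'

/-- Functionals that agree on generators are equal. -/
lemma Generates.dual_ext {P : Y.PresheafOfModules} {U : Y.Opens} {ι : Type}
    {e : ι → P.presheaf.obj (op U)} (he : Generates P e) {W : Y.Opens} (hW : W ≤ U)
    {q q' : (dual P).val.presheaf.obj (op W)}
    (h : ∀ i, pairing P le_rfl (PluriCanon.res P hW (e i)) q =
      pairing P le_rfl (PluriCanon.res P hW (e i)) q') : q = q' := by
  refine PluriCanon.dual_ext fun V hV x => fun_eq_of_locally fun y hy => ?_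
  obtain ⟨V', hV', hy', hx⟩ := he V (hV.trans hW) x y hy
  refine ⟨V', hV', hy', ?_⟩
  rw [← pairing_res_right, ← pairing_res_right]
  have key : Submodule.span Γ(Y, V')
      (Set.range fun i => PluriCanon.res P (hV'.trans (hV.trans hW)) (e i)) ≤
      LinearMap.eqLocus (evalApp (ofDual q) (hV'.trans hV))
        (evalApp (ofDual q') (hV'.trans hV)) := by
    rw [Submodule.span_le]
    rintro _ ⟨i, rfl⟩
    have := congrArg (fres (hV'.trans hV)) (h i)
    rw [← pairing_res_right, ← pairing_res_right, res_res] at this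
    exact this
  exact key hx

/-- Evaluation at finitely many generators of `P` separates the sections of the dual of `P`. -/
lemma FinGen.torsionless_dual {P : Y.PresheafOfModules} {U : Y.Opens} (hP : FinGen P U) :
    Torsionless (dual P).val U := by
  obtain ⟨ι, hι, e, he⟩ := hP
  refine ⟨ι, hι, fun i => ⟨fun V =>
    { toFun := pairing P le_rfl (PluriCanon.res P V.2 (e i))
      map_add' := map_add _
      map_smul' := fun c q => by rw [map_smulₛₗ, fres_self]; rfl }, ?_⟩, ?_⟩
  · intro V V' j q
    change pairing P le_rfl (res P V'.2 (e i)) (res (dual P).val j.le q) =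
      fres j.le (pairing P le_rfl (res P V.2 (e i)) q)
    rw [pairing_res_left, ← pairing_res_right, res_res]
  · intro V hV q hq
    refine he.dual_ext hV fun i => ?_
    rw [map_zero]
    exact hq i

end

/-! ### Duals of finitely generated presheaves -/

section
variable {Y : Scheme.{u}}

lemma fres_injective [IsReduced Y] {U V W : Y.Opens} (hU : IsPreirreducible (U : Set Y)) (h : V ≤ W)
    (hW : W ≤ U) (hV : (V : Set Y).Nonempty) : Function.Injective (fres h) :=
  presheaf_map_injective hU (homOfLE h) hW hV

lemma fres_inf_injective [IsReduced Y] {U V D : Y.Opens} (hU : IsPreirreducible (U : Set Y))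
    (hV : V ≤ U) (hD : D ≤ U) (hne : (D : Set Y).Nonempty) :
    Function.Injective (fres (inf_le_left : V ⊓ D ≤ V)) := by
  by_cases h : (V : Set Y).Nonempty
  · refine fres_injective hU _ hV ?_
    obtain ⟨y, hy⟩ := h
    obtain ⟨d, hd⟩ := hne
    obtain ⟨z, -, hz⟩ := hU V D V.2 D.2 ⟨y, hV hy, hy⟩ ⟨d, hD hd, hd⟩
    exact ⟨z, hz⟩
  · intro s t _
    exact fun_eq_of_locally fun y hy => (h ⟨y, hy⟩).elim

lemma isUnit_fres_basicOpen {U : Y.Opens} (b : Γ(Y, U)) :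
    IsUnit (fres (Y.basicOpen_le b) b) :=
  RingedSpace.isUnit_res_basicOpen _ b

lemma exists_fres_eq_pow_mul {U : Y.Opens} (hU : IsAffineOpen U) (b : Γ(Y, U))
    (s : Γ(Y, Y.basicOpen b)) :
    ∃ (k : ℕ) (a : Γ(Y, U)), fres (Y.basicOpen_le b) a = fres (Y.basicOpen_le b) b ^ k * s := by
  have := hU.isLocalization_basicOpen b
  obtain ⟨k, a, h⟩ := IsLocalization.Away.surj b s
  exact ⟨k, a, by rw [mul_comm]; exact h.symm⟩

lemma exists_forall_fres_eq_pow_mul {U : Y.Opens} (hU : IsAffineOpen U) (b : Γ(Y, U)) {ι : Type}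
    [Finite ι] (s : ι → Γ(Y, Y.basicOpen b)) :
    ∃ k : ℕ, ∀ i, ∃ a : Γ(Y, U),
      fres (Y.basicOpen_le b) a = fres (Y.basicOpen_le b) b ^ k * s i := by
  cases nonempty_fintype ι
  choose k a h using fun i => exists_fres_eq_pow_mul hU b (s i)
  refine ⟨Finset.univ.sup k, fun i => ⟨b ^ (Finset.univ.sup k - k i) * a i, ?_⟩⟩
  rw [map_mul, h, map_pow, ← mul_assoc, ← pow_add,
    Nat.sub_add_cancel (Finset.le_sup (Finset.mem_univ i))]

lemma pairing_smul_right (P : Y.PresheafOfModules) {W V : Y.Opens} (hV : V ≤ W) (c : Γ(Y, W))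
    (x : P.presheaf.obj (op V)) (q : (dual P).val.presheaf.obj (op W)) :
    pairing P hV x (c • q) = fres hV c * pairing P hV x q :=
  map_smulₛₗ (pairing P hV x) c q

/-- On an integral Noetherian affine open set, the dual of a finitely generated presheaf of modules
is finitely generated: its sections over `U` embed in a finite free module, and every section over
a principal open subset extends to `U` after multiplication by a power of the defining function.
-/
lemma FinGen.dual [IsReduced Y] {P : Y.PresheafOfModules} {U : Y.Opens} (hU : IsAffineOpen U)
    [IsDomain Γ(Y, U)] [IsNoetherianRing Γ(Y, U)] (hP : FinGen P U) : FinGen (dual P).val U := by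
  obtain ⟨ι, hι, e, he⟩ := hP
  have hirr : IsPreirreducible (U : Set Y) := (isIrreducible_of_isDomain hU).2
  let Φ : (PluriCanon.dual P).val.presheaf.obj (op U) →ₗ[Γ(Y, U)] (ι → Γ(Y, U)) :=
    { toFun q i := pairing P le_rfl (e i) q
      map_add' _ _ := funext fun i => map_add _ _ _
      map_smul' c q := funext fun i => by
        rw [map_smulₛₗ, fres_self]; rfl }
  have hΦ : Function.Injective Φ := fun q q' h => he.dual_ext le_rfl fun i => by
    rw [res_self]; exact congrFun h i
  have hfg : (⊤ : Submodule Γ(Y, U) ((PluriCanon.dual P).val.presheaf.obj (op U))).FG :=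
    (isNoetherian_of_injective Φ hΦ).noetherian ⊤
  obtain ⟨n, g, hg⟩ := Submodule.fg_iff_exists_fin_generating_family.mp hfg
  refine ⟨Fin n, inferInstance, g, fun V hV q y hy => ?_⟩
  obtain ⟨b, hbV, hyb⟩ := hU.exists_basicOpen_le ⟨y, hy⟩ (hV hy)
  refine ⟨Y.basicOpen b, hbV, hyb, ?_⟩
  obtain ⟨k, hk⟩ := exists_forall_fres_eq_pow_mul hU b
    (fun i => pairing P hbV (PluriCanon.res P (Y.basicOpen_le b) (e i)) q)
  choose a ha using hk
  let D : Y.Opens := Y.basicOpen b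
  let φ : (PluriCanon.dual P).val.presheaf.obj (op D) :=
    (fres (Y.basicOpen_le b) b ^ k) • res (PluriCanon.dual P).val hbV q
  obtain ⟨ψ, hψ⟩ := exists_homSections_extend (P := P) (N := structureSheaf Y) (D := D) (U := U)
    (fun V hV => fres_inf_injective hirr hV (Y.basicOpen_le b) ⟨y, hyb⟩) (ofDual φ) (by
      intro V hV p z hz
      obtain ⟨V', hV', hz', hp⟩ := he V hV p z hz
      refine ⟨V', hV', hz', ?_⟩
      have key : ∀ x ∈ Submodule.span Γ(Y, V')
          (Set.range fun i => PluriCanon.res P (hV'.trans hV) (e i)),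
          ∃ r : Γ(Y, V'), fres (inf_le_left : V' ⊓ D ≤ V') r =
            pairing P inf_le_right (PluriCanon.res P (inf_le_left : V' ⊓ D ≤ V') x) φ := by
        intro x hx
        induction hx using Submodule.span_induction with
        | mem x hx =>
          obtain ⟨i, rfl⟩ := hx
          refine ⟨fres (hV'.trans hV) (a i), ?_⟩
          have := congrArg (fres (inf_le_right : V' ⊓ D ≤ D)) (ha i)
          rw [fres_fres] at this
          rw [fres_fres, this, res_res, map_mul]
          refine Eq.trans ?_ (pairing_smul_right _ _ _ _ _).symm
          rw [pairing_res_left, ← pairing_res_right, res_res]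
        | zero => exact ⟨0, by rw [map_zero, map_zero]; exact (map_zero (evalApp _ _)).symm⟩
        | add x x' _ _ hx hx' =>
          obtain ⟨r, hr⟩ := hx
          obtain ⟨r', hr'⟩ := hx'
          exact ⟨r + r', by rw [map_add, map_add, pairing_add, hr, hr']⟩
        | smul c x _ hx =>
          obtain ⟨r, hr⟩ := hx
          exact ⟨c * r, by rw [map_mul, map_smulₛₗ (res P _), pairing_smul, hr]⟩
      obtain ⟨r, hr⟩ := key _ hp
      refine ⟨r, hr.trans ?_⟩
      rw [res_res]
      rfl)
  have hψφ : res (PluriCanon.dual P).val (Y.basicOpen_le b) (toDual ψ) = φ :=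
    PluriCanon.dual_ext fun V hV x => hψ V _ hV x
  have hmem : φ ∈ Submodule.span Γ(Y, D)
      (Set.range fun i => res (PluriCanon.dual P).val (Y.basicOpen_le b) (g i)) := by
    rw [← hψφ]
    exact res_mem_span _ (hg ▸ Submodule.mem_top)
  exact (Submodule.smul_mem_iff_of_isUnit _ ((isUnit_fres_basicOpen b).pow k)).mp hmem

end

/-! ### Generating sections generate locally -/

section
section Site
variable {C : Type u} [SmallCategory C] {J : GrothendieckTopology C} {R : Sheaf J RingCat.{u}}

lemma toSheafify_app_smul (P : PresheafOfModules.{u} R.obj) (X : Cᵒᵖ) (r : R.obj.obj X)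
    (p : P.obj X) :
    (show ((PresheafOfModules.sheafification (𝟙 R.obj)).obj P).val.obj X from
      (CategoryTheory.toSheafify J P.presheaf).app X (r • p : P.obj X)) =
    r • (show ((PresheafOfModules.sheafification (𝟙 R.obj)).obj P).val.obj X from
      (CategoryTheory.toSheafify J P.presheaf).app X p) :=
  (((PresheafOfModules.sheafificationAdjunction (𝟙 R.obj)).unit.app P).app X).hom.map_smul r p

lemma mem_of_cokernel_app_eq_zero {M : PresheafOfModules.{u} R.obj} (S : M.Submodule) {X : Cᵒᵖ}
    (x : M.obj X) (hx : (cokernel.π S.ι).app X x = 0) : x ∈ S.obj X := by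
  let T : ShortComplex (PresheafOfModules.{u} R.obj) :=
    ShortComplex.mk S.ι (cokernel.π S.ι) (cokernel.condition _)
  have hT : T.Exact := ShortComplex.exact_cokernel S.ι
  have hT' := hT.map (PresheafOfModules.evaluation R.obj X)
  rw [ShortComplex.moduleCat_exact_iff] at hT'
  obtain ⟨s, hs⟩ := hT' x hx
  rw [← hs]
  exact s.2

/-- Sections generating a sheaf of modules generate it locally: the quotient by the presheaf of
submodules that they span has zero associated sheaf. -/
lemma exists_sieve_map_mem_span {M : SheafOfModules.{u} R} (σ : M.GeneratingSections) (X : C)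
    (x : M.val.obj (op X)) :
    ∃ T ∈ J X, ∀ (X' : C) (f : X' ⟶ X), T f →
      M.val.map f.op x ∈ Submodule.span (R.obj.obj (op X'))
        (Set.range fun i => PresheafOfModules.sections.eval (σ.s i) (op X')) := by
  let S : M.val.Submodule :=
    { obj X := Submodule.span (R.obj.obj X) 
        (Set.range fun i => PresheafOfModules.sections.eval (σ.s i) X)
      map {X X'} f := by
        rw [Submodule.span_le]
        rintro _ ⟨i, rfl⟩
        exact Submodule.subset_span ⟨i, ((σ.s i).property f).symm⟩ }
  let Q := cokernel S.ι
  let c : M ⟶ (PresheafOfModules.sheafification (𝟙 R.obj)).obj Q :=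
    ⟨PresheafOfModules.homMk ((PresheafOfModules.toPresheaf _).map (cokernel.π S.ι) ≫
      CategoryTheory.toSheafify J Q.presheaf) (fun X r m => by
        have h : (cokernel.π S.ι).app X (r • m) = r • (cokernel.π S.ι).app X m :=
          map_smul ((cokernel.π S.ι).app X).hom r m
        exact (congrArg ((CategoryTheory.toSheafify J Q.presheaf).app X) h).trans
          (toSheafify_app_smul Q X r _))⟩
  have hc : c = 0 := by
    rw [← cancel_epi σ.π, comp_zero, SheafOfModules.freeHomEquiv_symm_comp,
      Equiv.symm_apply_eq]
    funext i
    refine PresheafOfModules.sections_ext _ _ fun X => ?_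
    have hi : (cokernel.π S.ι).app X (PresheafOfModules.sections.eval (σ.s i) X) = 0 :=
      congrArg (fun φ : S.toPresheafOfModules ⟶ Q => φ.app X
        ⟨PresheafOfModules.sections.eval (σ.s i) X, Submodule.subset_span ⟨i, rfl⟩⟩)
        (cokernel.condition S.ι)
    exact (congrArg ((CategoryTheory.toSheafify J Q.presheaf).app X) hi).trans (map_zero _)
  have hx : (CategoryTheory.toSheafify J Q.presheaf).app (op X)
      ((cokernel.π S.ι).app (op X) x) = 0 :=
    congrArg (fun φ : M ⟶ (PresheafOfModules.sheafification (𝟙 R.obj)).obj Q =>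
      φ.val.app (op X) x) hc
  refine ⟨_, Presheaf.equalizerSieve_mem J (CategoryTheory.toSheafify J Q.presheaf)
    (show Q.presheaf.obj (op X) from (cokernel.π S.ι).app (op X) x) 0
    (hx.trans (map_zero _).symm), fun X' f hf => ?_⟩
  refine mem_of_cokernel_app_eq_zero S _ ?_
  rw [PresheafOfModules.naturality_apply]
  exact hf.trans (map_zero _)

end Site

variable {Y : Scheme.{u}}

lemma finGen_of_generatingSections (M : Y.Modules) {U : Y.Opens}
    (σ : (SheafOfModules.over (R := Y.ringCatSheaf) M U).GeneratingSections) [Finite σ.I] :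
    FinGen M.val U := by
  obtain ⟨n, ⟨en⟩⟩ := Finite.exists_equiv_fin σ.I
  refine ⟨Fin n, inferInstance, fun k => (σ.s (en.symm k)).val (op (Over.mk (𝟙 U))), ?_⟩
  intro V hV p y hy
  obtain ⟨T, hT, hT'⟩ := exists_sieve_map_mem_span σ (Over.mk (homOfLE hV)) p
  rw [GrothendieckTopology.mem_over_iff] at hT
  obtain ⟨V', j, hj, hyV'⟩ := hT y hy
  refine ⟨V', j.le, hyV', ?_⟩
  rw [Sieve.overEquiv_iff] at hj
  have h := hT' _ _ hj
  refine (Submodule.span_mono (R := Γ(Y, V')) (M := M.val.presheaf.obj (op V')) ?_) h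
  rintro _ ⟨i, rfl⟩
  refine ⟨en i, ?_⟩
  change res M.val _ ((σ.s (en.symm (en i))).val (op (Over.mk (𝟙 U)))) = _
  rw [Equiv.symm_apply_apply]
  let t : Over.mk (j ≫ (Over.mk (homOfLE hV)).hom) ⟶ Over.mk (𝟙 U) :=
    Over.homMk (homOfLE (j.le.trans hV))
  exact (σ.s i).property t.op

lemma exists_finGen (M : Y.Modules)
    (h : SheafOfModules.IsFinitePresentation (R := Y.ringCatSheaf) M) (y : Y) :
    ∃ U : Y.Opens, y ∈ U ∧ FinGen M.val U := by
  obtain ⟨q, hq⟩ := h.exists_quasicoherentData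
  obtain ⟨U₀, f, ⟨i, ⟨g⟩⟩, hy⟩ := q.coversTop ⊤ y trivial
  have hfin : Finite (q.presentation i).generators.I :=
    (hq.isFinite_presentation i).isFiniteType_generators.finite
  exact ⟨q.X i, leOfHom g hy, finGen_of_generatingSections M (q.presentation i).generators⟩

end

/-! ### Tensor powers -/

section
variable {Y : Scheme.{u}}

/-- The presheaf tensor product `U ↦ A(U) ⊗ P(U)`. -/
def tensor (A P : Y.PresheafOfModules) : Y.PresheafOfModules :=
  MonoidalCategoryStruct.tensorObj
    (C := PresheafOfModules (Y.presheaf ⋙ forget₂ CommRingCat RingCat)) A P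

/-- The sections of the presheaf tensor product are the elements of the tensor product. -/
def toTensor (A P : Y.PresheafOfModules) (V : Y.Opens) :
    TensorProduct Γ(Y, V) (A.presheaf.obj (op V)) (P.presheaf.obj (op V)) ≃ₗ[Γ(Y, V)]
      (tensor A P).presheaf.obj (op V) where
  toFun x := x
  map_add' _ _ := rfl
  map_smul' _ _ := rfl
  invFun x := x
  left_inv _ := rfl
  right_inv _ := rfl

lemma res_toTensor_tmul (A P : Y.PresheafOfModules) {V V' : Y.Opens} (h : V' ≤ V)
    (a : A.presheaf.obj (op V)) (p : P.presheaf.obj (op V)) :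
    res (tensor A P) h (toTensor A P V (a ⊗ₜ p)) = toTensor A P V' (res A h a ⊗ₜ res P h p) := rfl

lemma Generates.tensor {A P : Y.PresheafOfModules} {U : Y.Opens} {ι κ : Type}
    {e : ι → A.presheaf.obj (op U)} {e' : κ → P.presheaf.obj (op U)} (he : Generates A e)
    (he' : Generates P e') :
    Generates (tensor A P) (fun k : ι × κ => toTensor A P U (e k.1 ⊗ₜ e' k.2)) := by
  intro V hV t y hy
  obtain ⟨x, rfl⟩ := (toTensor A P V).surjective t
  induction x using TensorProduct.induction_on with
  | zero => exact ⟨V, le_rfl, hy, by rw [map_zero, map_zero]; exact zero_mem _⟩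
  | add x x' hx hx' =>
    obtain ⟨V₁, h₁, hy₁, h₁'⟩ := hx
    obtain ⟨V₂, h₂, hy₂, h₂'⟩ := hx'
    refine ⟨V₁ ⊓ V₂, inf_le_left.trans h₁, ⟨hy₁, hy₂⟩, ?_⟩
    have h₁'' := res_mem_span (inf_le_left : V₁ ⊓ V₂ ≤ V₁) h₁'
    have h₂'' := res_mem_span (inf_le_right : V₁ ⊓ V₂ ≤ V₂) h₂'
    simp only [res_res] at h₁'' h₂''
    rw [map_add, map_add]
    exact add_mem h₁'' h₂''
  | tmul a p =>
    obtain ⟨V₁, h₁, hy₁, h₁'⟩ := he V hV a y hy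
    obtain ⟨V₂, h₂, hy₂, h₂'⟩ := he' V hV p y hy
    refine ⟨V₁ ⊓ V₂, inf_le_left.trans h₁, ⟨hy₁, hy₂⟩, ?_⟩
    have h₁'' := res_mem_span (inf_le_left : V₁ ⊓ V₂ ≤ V₁) h₁'
    have h₂'' := res_mem_span (inf_le_right : V₁ ⊓ V₂ ≤ V₂) h₂'
    simp only [res_res] at h₁'' h₂''
    rw [res_toTensor_tmul]
    have key := Submodule.apply_mem_map₂
      (TensorProduct.mk Γ(Y, V₁ ⊓ V₂) (A.presheaf.obj (op (V₁ ⊓ V₂)))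
        (P.presheaf.obj (op (V₁ ⊓ V₂)))) h₁'' h₂''
    rw [Submodule.map₂_span_span] at key
    have key' := Submodule.mem_map_of_mem (f := (toTensor A P (V₁ ⊓ V₂)).toLinearMap) key
    rw [Submodule.map_span] at key'
    refine Submodule.span_mono ?_ key'
    rintro _ ⟨_, ⟨_, ⟨i, rfl⟩, _, ⟨j, rfl⟩, rfl⟩, rfl⟩
    exact ⟨(i, j), rfl⟩

/-- The section `e` is a basis of `P` over every open subset of `U`. -/
def IsBasis (P : Y.PresheafOfModules) {U : Y.Opens} (e : P.presheaf.obj (op U)) : Prop :=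
  ∀ (V : Y.Opens) (hV : V ≤ U), Function.Bijective fun c : Γ(Y, V) => c • res P hV e

lemma IsBasis.generates {P : Y.PresheafOfModules} {U : Y.Opens} {e : P.presheaf.obj (op U)}
    (he : IsBasis P e) : Generates P (fun _ : Unit => e) := by
  intro V hV p y hy
  obtain ⟨c, rfl⟩ := (he V hV).2 p
  refine ⟨V, le_rfl, hy, ?_⟩
  rw [res_self]
  exact Submodule.smul_mem _ _ (Submodule.subset_span ⟨(), rfl⟩)

lemma isBasis_one (M : Y.Modules) (U : Y.Opens) :
    IsBasis (presheafTensorPower M 0) (show Γ(Y, U) from 1) := by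
  intro V hV
  have h : ∀ c : Γ(Y, V), c * fres hV 1 = c := fun c => by rw [map_one, mul_one]
  exact ⟨fun c c' hc => (h c).symm.trans (hc.trans (h c')), fun c => ⟨c, h c⟩⟩

lemma finGen_presheafTensorPower {M : Y.Modules} {U : Y.Opens} (hM : FinGen M.val U) (m : ℕ) :
    FinGen (presheafTensorPower M m) U := by
  induction m with
  | zero => exact ⟨Unit, inferInstance, _, (isBasis_one M U).generates⟩
  | succ m ih =>
    obtain ⟨ι, hι, e, he⟩ := ih
    obtain ⟨κ, hκ, e', he'⟩ := hM
    exact ⟨ι × κ, inferInstance, _, he.tensor he'⟩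

lemma IsBasis.tensor {A P : Y.PresheafOfModules} {U : Y.Opens}
    {e : A.presheaf.obj (op U)} {e' : P.presheaf.obj (op U)} (he : IsBasis A e)
    (he' : IsBasis P e') : IsBasis (tensor A P) (toTensor A P U (e ⊗ₜ e')) := by
  intro V hV
  let u := LinearEquiv.ofBijective (LinearMap.toSpanSingleton Γ(Y, V) _ (res A hV e)) (he V hV)
  let v := LinearEquiv.ofBijective (LinearMap.toSpanSingleton Γ(Y, V) _ (res P hV e')) (he' V hV)
  let w := (TensorProduct.rid Γ(Y, V) Γ(Y, V)).symm ≪≫ₗ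
    TensorProduct.congr u v ≪≫ₗ toTensor A P V
  convert w.bijective using 1
  funext c
  change c • toTensor A P V (res A hV e ⊗ₜ res P hV e') =
    toTensor A P V ((c • res A hV e) ⊗ₜ[Γ(Y, V)] ((1 : Γ(Y, V)) • res P hV e'))
  rw [one_smul]
  refine (map_smul (toTensor A P V) c _).symm.trans ?_
  rw [TensorProduct.smul_tmul']

lemma IsBasis.exists_presheafTensorPower {M : Y.Modules} {U : Y.Opens}
    {e : M.val.presheaf.obj (op U)} (he : IsBasis M.val e) (m : ℕ) :
    ∃ e' : (presheafTensorPower M m).presheaf.obj (op U), IsBasis (presheafTensorPower M m) e' := by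
  induction m with
  | zero => exact ⟨_, isBasis_one M U⟩
  | succ m ih =>
    obtain ⟨e', he'⟩ := ih
    exact ⟨_, he'.tensor he⟩

end

/-! ### Sheafification and invertible sheaves -/

section
variable {Y : Scheme.{u}}

/-- The sheaf of modules associated with a presheaf of modules. -/
abbrev sheafify (P : Y.PresheafOfModules) : Y.Modules :=
  (PresheafOfModules.sheafification (𝟙 Y.ringCatSheaf.obj)).obj P

/-- The unit of sheafification on sections over `V`, as a linear map. -/
def toSheafified (P : Y.PresheafOfModules) (V : Y.Opens) :
    P.presheaf.obj (op V) →ₗ[Γ(Y, V)] (sheafify P).val.presheaf.obj (op V) where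
  toFun x := (CategoryTheory.toSheafify (Opens.grothendieckTopology Y) P.presheaf).app (op V) x
  map_add' := map_add _
  map_smul' r x := toSheafify_app_smul (R := Y.ringCatSheaf) P (op V) r x

lemma toSheafified_res (P : Y.PresheafOfModules) {V V' : Y.Opens} (h : V' ≤ V)
    (x : P.presheaf.obj (op V)) :
    toSheafified P V' (res P h x) = res (sheafify P).val h (toSheafified P V x) :=
  NatTrans.naturality_apply (CategoryTheory.toSheafify (Opens.grothendieckTopology Y) P.presheaf)
    (homOfLE h).op x

lemma exists_toSheafified_eq (P : Y.PresheafOfModules) {V : Y.Opens}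
    (s : (sheafify P).val.presheaf.obj (op V)) {y : Y} (hy : y ∈ V) :
    ∃ (V' : Y.Opens) (h : V' ≤ V), y ∈ V' ∧
      ∃ x, toSheafified P V' x = res (sheafify P).val h s := by
  obtain ⟨V', j, ⟨x, hx⟩, hyV'⟩ := Presheaf.imageSieve_mem (Opens.grothendieckTopology Y)
    (CategoryTheory.toSheafify (Opens.grothendieckTopology Y) P.presheaf) (U := op V) s y hy
  exact ⟨V', j.le, hyV', x, hx⟩

lemma exists_res_eq_zero_of_toSheafified (P : Y.PresheafOfModules) {V : Y.Opens}
    (x : P.presheaf.obj (op V)) (hx : toSheafified P V x = 0) {y : Y} (hy : y ∈ V) :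
    ∃ (V' : Y.Opens) (h : V' ≤ V), y ∈ V' ∧ res P h x = 0 := by
  obtain ⟨V', j, h, hyV'⟩ := Presheaf.equalizerSieve_mem (Opens.grothendieckTopology Y)
    (CategoryTheory.toSheafify (Opens.grothendieckTopology Y) P.presheaf) (X := op V) x 0
    (hx.trans (map_zero _).symm) y hy
  exact ⟨V', j.le, hyV', h.trans (map_zero _)⟩

lemma map_mem_span_range {R A B : Type*} [CommRing R] [AddCommGroup A] [Module R A] [AddCommGroup B]
    [Module R B] (f : A →ₗ[R] B) {ι : Type*} {s : ι → A} {x : A}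
    (hx : x ∈ Submodule.span R (Set.range s)) :
    f x ∈ Submodule.span R (Set.range fun i => f (s i)) := by
  have := Submodule.mem_map_of_mem (f := f) hx
  rwa [Submodule.map_span, ← Set.range_comp] at this

lemma Generates.sheafify {P : Y.PresheafOfModules} {U : Y.Opens} {ι : Type}
    {e : ι → P.presheaf.obj (op U)} (he : Generates P e) :
    Generates (sheafify P).val (fun i => toSheafified P U (e i)) := by
  intro V hV s y hy
  obtain ⟨V₁, h₁, hy₁, x, hx⟩ := exists_toSheafified_eq P s hy
  obtain ⟨V₂, h₂, hy₂, hx₂⟩ := he V₁ (h₁.trans hV) x y hy₁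
  refine ⟨V₂, h₂.trans h₁, hy₂, ?_⟩
  rw [← res_res _ h₂ h₁, ← hx, ← toSheafified_res]
  have := map_mem_span_range (toSheafified P V₂) hx₂
  simpa only [toSheafified_res] using this

/-- The sheaf associated with a presheaf of modules that is free with basis `e` over `U` is
torsionless over `U`: the coordinate with respect to `e` is a functional. -/
lemma IsBasis.torsionless_sheafify {P : Y.PresheafOfModules} {U : Y.Opens}
    {e : P.presheaf.obj (op U)} (he : IsBasis P e) : Torsionless (PluriCanon.sheafify P).val U := by
  have hinj : ∀ (V : Y.Opens) (hV : V ≤ U) (c c' : Γ(Y, V)),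
      c • res (PluriCanon.sheafify P).val hV (toSheafified P U e) =
        c' • res (PluriCanon.sheafify P).val hV (toSheafified P U e) → c = c' := by
    intro V hV c c' h
    rw [← toSheafified_res, ← map_smul (toSheafified P V), ← map_smul (toSheafified P V),
      ← sub_eq_zero, ← map_sub] at h
    refine fun_eq_of_locally fun y hy => ?_
    obtain ⟨V', hV', hy', h'⟩ := exists_res_eq_zero_of_toSheafified P _ h hy
    refine ⟨V', hV', hy', (he V' (hV'.trans hV)).1 ?_⟩
    rwa [map_sub, map_smulₛₗ, map_smulₛₗ, res_res, sub_eq_zero] at h'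
  obtain ⟨ψ, hψ⟩ := exists_homSections_of_rel (PluriCanon.sheafify P).val (structureSheaf Y)
    (U := U)
    (fun V hV p r =>
      p = (show Γ(Y, V) from r) • res (PluriCanon.sheafify P).val hV (toSheafified P U e))
    (fun V hV p r r' h h' => hinj V hV _ _ (h.symm.trans h'))
    (fun V hV p p' r r' h h' => by
      rw [h, h']; exact (add_smul (show Γ(Y, V) from r) r' _).symm)
    (fun V hV c p r h => by rw [h]; exact (mul_smul c (show Γ(Y, V) from r) _).symm)
    (fun V hV V' h p r e => by rw [e, map_smulₛₗ, res_res]; rfl)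
    (fun V hV p r h => eq_of_locally_res_eq _ fun y hy => by
      obtain ⟨V', hV', hy', h'⟩ := h y hy
      refine ⟨V', hV', hy', ?_⟩
      rw [h', map_smulₛₗ, res_res]
      rfl)
    (fun V hV p y hy => by
      obtain ⟨V', hV', hy', h'⟩ := he.generates.sheafify V hV p y hy
      obtain ⟨c, hc⟩ := Submodule.mem_span_range_iff_exists_fun _ |>.mp h'
      rw [Fintype.sum_unique] at hc
      exact ⟨V', hV', hy', c (), hc.symm⟩)
  refine ⟨Unit, inferInstance, fun _ => ψ, fun V hV x hx => ?_⟩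
  refine (hψ V hV x).trans ?_
  change evalApp ψ hV x • _ = _
  rw [hx (), zero_smul]

lemma IsInvertible.exists_isBasis {M : Y.Modules} (hM : IsInvertible M) (y : Y) :
    ∃ U : Y.Opens, y ∈ U ∧ ∃ e : M.val.presheaf.obj (op U), IsBasis M.val e := by
  obtain ⟨U, hyU, ⟨φ⟩⟩ := hM y
  let u : (SheafOfModules.unit (U : Scheme.{u}).ringCatSheaf : Scheme.Modules U) ⟶
    M.restrict U.ι := φ.inv
  let uapp (V : Scheme.Opens (U : Scheme.{u})) (c : Γ((U : Scheme.{u}), V)) :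
      M.val.presheaf.obj (op (U.ι ''ᵁ V)) := u.val.app (op V) c
  have hu : ∀ V, Function.Bijective (uapp V) := fun V =>
    have : IsIso (Scheme.Modules.Hom.app φ.inv V) :=
      Scheme.Modules.Hom.isIso_iff_isIso_app.mp (Iso.isIso_inv φ) V
    ConcreteCategory.bijective_of_isIso (Scheme.Modules.Hom.app φ.inv V)
  have hsmul : ∀ V c, uapp V c = (U.ι.appIso V).inv c • uapp V 1 := fun V c =>
    (congrArg (uapp V) (mul_one c).symm).trans
      (Scheme.Modules.Hom.app_smul φ.inv c (show Γ((U : Scheme.{u}), V) from 1))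
  have hres : ∀ V (h : U.ι ''ᵁ V ≤ U.ι ''ᵁ ⊤), res M.val h (uapp ⊤ 1) = uapp V 1 := fun V h => by
    have := PresheafOfModules.naturality_apply u.val (homOfLE (le_top : V ≤ ⊤)).op
      (1 : Γ((U : Scheme.{u}), ⊤))
    refine this.symm.trans ?_
    exact congrArg (uapp V) (map_one (fres (le_top : V ≤ ⊤)))
  refine ⟨U.ι ''ᵁ ⊤, ⟨⟨y, hyU⟩, trivial, rfl⟩, uapp ⊤ 1, fun V hV => ?_⟩
  obtain ⟨V, rfl⟩ : ∃ V', V = U.ι ''ᵁ V' := ⟨U.ι ⁻¹ᵁ V, by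
    rw [Scheme.Hom.image_preimage_eq_opensRange_inf, Scheme.Hom.image_top_eq_opensRange] at *
    exact (inf_eq_right.mpr hV).symm⟩
  have h : (fun c : Γ(Y, U.ι ''ᵁ V) => c • res M.val hV (uapp ⊤ 1)) =
      fun c => uapp V ((U.ι.appIso V).hom c) := by
    funext c
    rw [hres, hsmul V ((U.ι.appIso V).hom c)]
    congr 1
    exact (ConcreteCategory.congr_hom (U.ι.appIso V).hom_inv_id c).symm
  rw [h]
  exact (hu V).comp (ConcreteCategory.bijective_of_isIso (U.ι.appIso V).hom)

end

/-! ### Denominators, equations of divisors, and extension of sections -/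

section
variable {Y : Scheme.{u}}

lemma fres_appLE {X : Scheme.{u}} (f : Y ⟶ X) {W : X.Opens} {V V' : Y.Opens}
    (e : V ≤ f ⁻¹ᵁ W) (h : V' ≤ V) (a : Γ(X, W)) :
    fres h (f.appLE W V e a) = f.appLE W V' (h.trans e) a :=
  map_appLE_apply f e (homOfLE h) a

lemma fun_subsingleton {V : Y.Opens} (hV : ¬ (V : Set Y).Nonempty) (s t : Γ(Y, V)) : s = t :=
  fun_eq_of_locally fun y hy => (hV ⟨y, hy⟩).elim

/-- Over an integral affine open `W ⊆ X`, every function on a piece of `f⁻¹(W)` is a fraction of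
functions on `W`. -/
lemma exists_ne_zero_mul_eq_appLE {X : Scheme.{u}} [IsReduced Y] {f : Y ⟶ X} (hf : IsBirational f)
    {W : X.Opens} (hW : IsAffineOpen W) [IsDomain Γ(X, W)] {V : Y.Opens} (hV : V ≤ f ⁻¹ᵁ W)
    (z : Γ(Y, V)) : ∃ d : Γ(X, W), d ≠ 0 ∧ ∃ a, f.appLE W V hV d * z = f.appLE W V hV a := by
  by_cases hne : (V : Set Y).Nonempty
  · have hWirr := isIrreducible_of_isDomain hW
    have hV₀ := isPreirreducible_preimage hf hWirr.2
    obtain ⟨U₀, -, hU₀', _⟩ := hf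
    obtain ⟨y, hy, hyU⟩ := hU₀'.inter_open_nonempty _ V.2 hne
    obtain ⟨h, a, hh, e⟩ := exists_mul_eq_appLE hW hV₀ (x := f y) hyU (hV hy) hV
      (fun y' hy' => by rwa [← eq_of_isIso_morphismRestrict (f := f) hyU hy'.symm]) z
    refine ⟨h, ?_, a, e⟩
    rintro rfl
    rw [Scheme.basicOpen_zero] at hh
    exact hh
  · exact ⟨1, one_ne_zero, 0, fun_subsingleton hne _ _⟩

/-- A common denominator for finitely many functions. -/
lemma exists_common_denominator {X : Scheme.{u}} [IsReduced Y] {f : Y ⟶ X} (hf : IsBirational f)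
    {W : X.Opens} (hW : IsAffineOpen W) [IsDomain Γ(X, W)] {ι : Type*} [Finite ι] (V : ι → Y.Opens)
    (hV : ∀ i, V i ≤ f ⁻¹ᵁ W) (z : ∀ i, Γ(Y, V i)) :
    ∃ d : Γ(X, W), d ≠ 0 ∧ ∀ i, ∃ a,
      f.appLE W (V i) (hV i) d * z i = f.appLE W (V i) (hV i) a := by
  classical
  cases nonempty_fintype ι
  choose d hd a ha using fun i => exists_ne_zero_mul_eq_appLE hf hW (hV i) (z i)
  refine ⟨∏ i, d i, Finset.prod_ne_zero_iff.mpr fun i _ => hd i, fun i =>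
    ⟨(∏ j ∈ Finset.univ.erase i, d j) * a i, ?_⟩⟩
  rw [← Finset.prod_erase_mul Finset.univ d (Finset.mem_univ i), map_mul, mul_assoc, ha, map_mul]

lemma fun_mul_left_cancel [IsReduced Y] {U V : Y.Opens} (hU : IsPreirreducible (U : Set Y))
    (hVU : V ≤ U) {d s t : Γ(Y, V)} (hd : d ≠ 0) (h : d * s = d * t) : s = t := by
  rw [← sub_eq_zero, ← mul_sub] at h
  rw [← sub_eq_zero]
  by_contra hne
  rw [← basicOpen_eq_bot_iff] at hne
  rw [Ne, ← basicOpen_eq_bot_iff] at hd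
  have key : ∀ O : Y.Opens, O ≠ ⊥ → (O : Set Y).Nonempty := fun O hO => by
    rw [Set.nonempty_iff_ne_empty]
    exact fun h => hO (Opens.ext h)
  obtain ⟨y, hy⟩ := key _ hne
  obtain ⟨y', hy'⟩ := key _ hd
  obtain ⟨z, -, hz, hz'⟩ := hU _ _ (Y.basicOpen d).2 (Y.basicOpen (s - t)).2
    ⟨y', hVU (Y.basicOpen_le _ hy'), hy'⟩ ⟨y, hVU (Y.basicOpen_le _ hy), hy⟩
  have : z ∈ Y.basicOpen (d * (s - t)) := by
    rw [Scheme.basicOpen_mul]; exact ⟨hz, hz'⟩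
  rw [h, Scheme.basicOpen_zero] at this
  exact this

lemma mem_reducedIdeal_iff (E : Closeds Y) {U : Y.Opens} (s : Γ(Y, U)) :
    s ∈ reducedIdeal E U ↔ ∀ y ∈ U, y ∈ E → y ∉ Y.basicOpen s := by
  rw [mem_reducedIdeal]
  refine forall_congr' fun y => forall_congr' fun hy => imp_congr_right fun _ => ?_
  rw [Scheme.mem_basicOpen _ _ _ hy, IsLocalRing.mem_maximalIdeal, mem_nonunits_iff]

/-- An equation of `E` on an affine open set restricts to an equation of `E` on a principal open
subset. -/
lemma reducedIdeal_basicOpen (E : Closeds Y) {U : Y.Opens} (hU : IsAffineOpen U) {g : Γ(Y, U)}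
    (hg : reducedIdeal E U = Ideal.span {g}) (b : Γ(Y, U)) :
    reducedIdeal E (Y.basicOpen b) = Ideal.span {fres (Y.basicOpen_le b) g} := by
  refine le_antisymm (fun i hi => ?_) ?_
  · obtain ⟨k, a, ha⟩ := exists_fres_eq_pow_mul hU b i
    -- the factor `b` makes `a` vanish at the points of `E` outside the principal open subset
    have hab : a * b ∈ reducedIdeal E U := by
      rw [mem_reducedIdeal_iff] at hi ⊢
      intro y hy hyE hyab
      rw [Scheme.basicOpen_mul] at hyab
      have hya : y ∈ Y.basicOpen (fres (Y.basicOpen_le b) a) :=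
        (Y.basicOpen_res a (homOfLE (Y.basicOpen_le b)).op).ge ⟨hyab.2, hyab.1⟩
      rw [ha, Scheme.basicOpen_mul] at hya
      exact hi y hyab.2 hyE hya.2
    rw [hg, Ideal.mem_span_singleton] at hab
    obtain ⟨c, hc⟩ := hab
    rw [Ideal.mem_span_singleton, ← ((isUnit_fres_basicOpen b).pow (k + 1)).dvd_mul_left]
    refine ⟨fres (Y.basicOpen_le b) c, ?_⟩
    rw [← map_mul, ← hc, map_mul, ha]
    ring
  · rw [Ideal.span_singleton_le_iff_mem]
    refine reducedIdeal_map_le E (homOfLE (Y.basicOpen_le b)) (Ideal.mem_map_of_mem _ ?_)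
    rw [hg]
    exact Ideal.mem_span_singleton_self g

/-- The complement of a Cartier divisor is locally the locus where the equation is invertible. -/
lemma basicOpen_eq_of_reducedIdeal (E : Closeds Y) {U : Y.Opens} (hU : IsAffineOpen U) {g : Γ(Y, U)}
    (hg : reducedIdeal E U = Ideal.span {g}) : Y.basicOpen g = U ⊓ openCompl E := by
  have hgE : g ∈ reducedIdeal E U := by rw [hg]; exact Ideal.mem_span_singleton_self g
  rw [mem_reducedIdeal_iff] at hgE
  refine le_antisymm (fun y hy => ⟨Y.basicOpen_le g hy, fun hyE =>
    hgE y (Y.basicOpen_le g hy) hyE hy⟩) fun y hy => ?_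
  obtain ⟨b, hb, hyb⟩ := hU.exists_basicOpen_le ⟨y, hy⟩ hy.1
  have hbE : b ∈ reducedIdeal E U := by
    rw [mem_reducedIdeal_iff]
    exact fun z _ hzE hz => (hb hz).2 hzE
  rw [hg, Ideal.mem_span_singleton] at hbE
  obtain ⟨c, rfl⟩ := hbE
  rw [Scheme.basicOpen_mul] at hyb
  exact hyb.1

lemma Torsionless.res_inf_injective [IsReduced Y] {P : Y.PresheafOfModules} {U V D : Y.Opens}
    (hP : Torsionless P U) (hU : IsPreirreducible (U : Set Y)) (hV : V ≤ U) (hD : D ≤ U)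
    (hne : (D : Set Y).Nonempty) : Function.Injective (res P (inf_le_left : V ⊓ D ≤ V)) := by
  obtain ⟨κ, -, φ, hφ⟩ := hP
  rw [injective_iff_map_eq_zero]
  intro x hx
  refine hφ V hV x fun k => fres_inf_injective hU hV hD hne ?_
  rw [← evalApp_res, hx, map_zero, map_zero]

lemma Torsionless.res_injective [IsReduced Y] {P : Y.PresheafOfModules} {U V W : Y.Opens}
    (hP : Torsionless P U) (hU : IsPreirreducible (U : Set Y)) (h : V ≤ W) (hW : W ≤ U)
    (hne : (V : Set Y).Nonempty) : Function.Injective (res P h) := by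
  obtain ⟨κ, -, φ, hφ⟩ := hP
  rw [injective_iff_map_eq_zero]
  intro x hx
  refine hφ W hW x fun k => fres_injective hU h hW hne ?_
  rw [← evalApp_res, hx, map_zero, map_zero]

/-- An ideal of functions on an affine open set some element of which is invertible at each point
of the locus where `g` is invertible contains a power of `g`. -/
lemma exists_pow_mem_of_forall_basicOpen {U : Y.Opens} (hU : IsAffineOpen U) (I : Ideal Γ(Y, U))
    (g : Γ(Y, U)) (h : ∀ y ∈ Y.basicOpen g, ∃ c ∈ I, y ∈ Y.basicOpen c) : ∃ n : ℕ, g ^ n ∈ I := by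
  change g ∈ I.radical
  rw [Ideal.radical_eq_sInf, Submodule.mem_sInf]
  rintro p ⟨hIp, hp⟩
  by_contra hg
  have key : ∀ c : Γ(Y, U), hU.fromSpec ⟨p, hp⟩ ∈ Y.basicOpen c ↔ c ∉ p := fun c => by
    change (⟨p, hp⟩ : PrimeSpectrum Γ(Y, U)) ∈ hU.fromSpec ⁻¹ᵁ Y.basicOpen c ↔ _
    rw [hU.fromSpec_preimage_basicOpen]
    rfl
  obtain ⟨c, hcI, hc⟩ := h _ ((key g).2 hg)
  exact (key c).1 hc (hIp hcI)

/-- A section over the locus where `g` is invertible extends after multiplication by a power of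
`g`. -/
lemma exists_res_eq_pow_smul [IsReduced Y] {F : Y.PresheafOfModules} {U : Y.Opens}
    (hU : IsAffineOpen U) (hirr : IsPreirreducible (U : Set Y)) (hfg : FinGen F U)
    (htl : Torsionless F U) (g : Γ(Y, U)) (s : F.presheaf.obj (op (Y.basicOpen g))) :
    ∃ (n : ℕ) (t : F.presheaf.obj (op U)),
      res F (Y.basicOpen_le g) t = fres (Y.basicOpen_le g) g ^ n • s := by
  obtain ⟨ι, hι, e, he⟩ := hfg
  cases nonempty_fintype ι
  -- the functions `c` for which `c • s` extends to `U`
  let I : Ideal Γ(Y, U) :=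
    { carrier := {c | ∃ t, res F (Y.basicOpen_le g) t = fres (Y.basicOpen_le g) c • s}
      add_mem' := by
        rintro c c' ⟨t, ht⟩ ⟨t', ht'⟩
        exact ⟨t + t', by rw [map_add, ht, ht', map_add, add_smul]⟩
      zero_mem' := ⟨0, by rw [map_zero, map_zero, zero_smul]⟩
      smul_mem' := by
        rintro c c' ⟨t, ht⟩
        exact ⟨c • t, by rw [map_smulₛₗ, ht, smul_eq_mul, map_mul, mul_smul]⟩ }
  obtain ⟨n, t, ht⟩ := exists_pow_mem_of_forall_basicOpen hU I g fun y hy => by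
    obtain ⟨V, hV, hyV, hs⟩ := he _ (Y.basicOpen_le g) s y hy
    obtain ⟨b, hbV, hyb⟩ := hU.exists_basicOpen_le ⟨y, hyV⟩ (Y.basicOpen_le g hy)
    obtain ⟨c, hc⟩ := Submodule.mem_span_range_iff_exists_fun _ |>.mp hs
    obtain ⟨k, hk⟩ := exists_forall_fres_eq_pow_mul hU b (fun i => fres hbV (c i))
    choose a ha using hk
    refine ⟨b ^ k, ⟨∑ i, a i • e i, ?_⟩, ?_⟩
    · refine htl.res_injective hirr (hbV.trans hV) (Y.basicOpen_le g) ⟨y, hyb⟩ ?_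
      rw [res_res, map_smulₛₗ, fres_fres, ← res_res F hbV hV, ← hc, map_sum, map_sum,
        Finset.smul_sum]
      refine Finset.sum_congr rfl fun i _ => ?_
      rw [map_smulₛₗ, map_smulₛₗ, res_res, ← mul_smul, ha, map_pow]
    · rcases k with _ | k
      · rw [pow_zero, Scheme.basicOpen_one]
        exact Y.basicOpen_le g hy
      · rw [Scheme.basicOpen_pow _ _ k.succ_pos]
        exact hyb
  exact ⟨n, t, by rw [ht, map_pow]⟩

end

/-! ### Boundedness of poles -/

section
variable {X Y : Scheme.{u}}

/-- `P` is locally finitely generated and locally torsionless. -/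
def LocallyFinGenTorsionless (P : Y.PresheafOfModules) : Prop :=
  ∀ y : Y, ∃ U : Y.Opens, y ∈ U ∧ FinGen P U ∧ Torsionless P U

/-- There is one denominator `d` for the values of the functionals `φ k` on all sections of `F` off
`E`. It is a common denominator for the values on the generators of `F` over a finite cover of `Y`;
near the fibre of a point over which `f` is an isomorphism, a section off `E` is a combination of
generators with regular coefficients, because `E` does not meet this fibre. -/
lemma exists_denominator_of_functional [IsReduced Y] [IsLocallyNoetherian X] [CompactSpace Y]
    (hX : IsNormal X) (f : Y ⟶ X) [IsProper f] (hf : IsBirational f)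
    {F : Y.PresheafOfModules} (hF : LocallyFinGenTorsionless F) (E : Closeds Y)
    (hE : (E : Set Y) ⊆ exceptionalLocus f) {W : X.Opens} (hW : IsAffineOpen W) [IsDomain Γ(X, W)]
    {U : Y.Opens} (hU : U ≤ f ⁻¹ᵁ W) {κ : Type} [Finite κ]
    (φ : κ → homSections F (structureSheaf Y) U) :
    ∃ d : Γ(X, W), d ≠ 0 ∧ ∀ (s : F.presheaf.obj (op (openCompl E))) (V : Y.Opens) (hVU : V ≤ U)
      (hVE : V ≤ openCompl E), (V : Set Y).Nonempty → ∀ k, ∃ a : Γ(X, W),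
        f.appLE W V (hVU.trans hU) d * evalApp (φ k) hVU (res F hVE s) =
          f.appLE W V (hVU.trans hU) a := by
  choose N hyN hN _ using hF
  obtain ⟨t, ht⟩ := isCompact_univ.elim_finite_subcover (fun y => (N y : Set Y)) (fun y => (N y).2)
    (fun y _ => Set.mem_iUnion.2 ⟨y, hyN y⟩)
  choose ι hι e he using hN
  let Idx := Σ y : t, κ × ι y.1
  have : ∀ y : t, Finite (κ × ι y.1) := fun y => inferInstance
  have : Finite Idx := inferInstance
  obtain ⟨d, hd, hdk⟩ := exists_common_denominator hf hW (ι := Idx) (fun i => U ⊓ N i.1.1)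
    (fun i => inf_le_left.trans hU)
    (fun i => evalApp (φ i.2.1) inf_le_left (res F inf_le_right (e i.1.1 i.2.2)))
  choose a ha using hdk
  refine ⟨d, hd, fun s V hVU hVE hne k => ?_⟩
  obtain ⟨a', ha'⟩ := exists_eq_appLE hX f hf hW (hVU.trans hU) hne
    (f.appLE W V (hVU.trans hU) d * evalApp (φ k) hVU (res F hVE s)) (by
      intro x hxW U₀ hxU₀ hiso
      obtain ⟨y, rfl⟩ := exists_mem_of_isIso_morphismRestrict (f := f) hxU₀
      have hyE : y ∈ openCompl E := fun h => notMem_exceptionalLocus (f := f) (U := U₀) hxU₀ (hE h)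
      obtain ⟨y₀, hy₀, hyN₀⟩ : ∃ y₀ ∈ t, y ∈ N y₀ := by
        simpa using ht (Set.mem_univ y)
      obtain ⟨V', hV', hyV', hs⟩ := he y₀ (N y₀ ⊓ openCompl E ⊓ f ⁻¹ᵁ W)
        (inf_le_left.trans inf_le_left) (res F (inf_le_left.trans inf_le_right) s) y
        ⟨⟨hyN₀, hyE⟩, hxW⟩
      have : Finite (ι y₀) := hι y₀
      cases nonempty_fintype (ι y₀)
      obtain ⟨c, hc⟩ := Submodule.mem_span_range_iff_exists_fun _ |>.mp hs
      refine ⟨V', hV'.trans inf_le_right, fun y' hy' => ?_, ?_⟩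
      · rwa [← eq_of_isIso_morphismRestrict (f := f) hxU₀ hy'.symm]
      refine ⟨∑ j, c j * f.appLE W V' (hV'.trans inf_le_right) (a ⟨⟨y₀, hy₀⟩, k, j⟩), ?_⟩
      change fres inf_le_left _ = fres inf_le_right _
      have hVN : V ⊓ V' ≤ U ⊓ N y₀ := inf_le_inf hVU (hV'.trans (inf_le_left.trans inf_le_left))
      have hs' : res F (inf_le_left.trans hVE : V ⊓ V' ≤ openCompl E) s =
          ∑ j, fres (inf_le_right : V ⊓ V' ≤ V') (c j) •
            res F (hVN.trans inf_le_right) (e y₀ j) := by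
        have := congrArg (res F (inf_le_right : V ⊓ V' ≤ V')) hc
        rw [res_res, res_res, map_sum] at this
        rw [← this]
        refine Finset.sum_congr rfl fun j _ => ?_
        rw [map_smulₛₗ, res_res]
      rw [map_mul, fres_appLE, ← evalApp_res, res_res, hs', map_sum, map_sum, Finset.mul_sum]
      refine Finset.sum_congr rfl fun j _ => ?_
      have := congrArg (fres hVN) (ha ⟨⟨y₀, hy₀⟩, k, j⟩)
      rw [map_mul, fres_appLE, fres_appLE, ← evalApp_res, res_res] at this
      rw [map_smul, smul_eq_mul, map_mul, fres_appLE, ← this]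
      ring)
  exact ⟨a', ha'⟩

/-- The poles along `E` of the sections of `F` off `E` are bounded on `U`: up to the denominator
`d`, the functionals embed these sections in a finite free module over the Noetherian ring
`Γ(X, W)`. -/
lemma exists_uniform_pow [IsReduced Y] [IsLocallyNoetherian X] [CompactSpace Y]
    (hX : IsNormal X) (f : Y ⟶ X) [IsProper f] (hf : IsBirational f)
    {F : Y.PresheafOfModules} (hF : LocallyFinGenTorsionless F) (E : Closeds Y)
    (hE : (E : Set Y) ⊆ exceptionalLocus f) {W : X.Opens} (hW : IsAffineOpen W) [IsDomain Γ(X, W)]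
    {U : Y.Opens} (hUW : U ≤ f ⁻¹ᵁ W) (hU : IsAffineOpen U) (hirr : IsPreirreducible (U : Set Y))
    (hfg : FinGen F U) (htl : Torsionless F U) (g : Γ(Y, U))
    (hgE : Y.basicOpen g ≤ openCompl E) (hne : (Y.basicOpen g : Set Y).Nonempty) :
    ∃ n : ℕ, ∀ s : F.presheaf.obj (op (openCompl E)), ∃ t : F.presheaf.obj (op U),
      res F (Y.basicOpen_le g) t = fres (Y.basicOpen_le g) g ^ n • res F hgE s := by
  obtain ⟨κ, hκ, φ, hφ⟩ := id htl
  obtain ⟨d, hd, hdφ⟩ := exists_denominator_of_functional hX f hf hF E hE hW hUW φ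
  have := hX.isReduced
  have hgU := Y.basicOpen_le g
  have hgW := hgU.trans hUW
  have hWirr := isIrreducible_of_isDomain hW
  have hinj := appLE_injective hf hWirr.2 hgW hne
  have hd' : f.appLE W (Y.basicOpen g) hgW d ≠ 0 := fun h => hd (hinj (h.trans (map_zero _).symm))
  have : IsNoetherianRing Γ(X, W) := IsLocallyNoetherian.component_noetherian ⟨W, hW⟩
  -- the vectors with components `d * φ k s`, for sections `s` over the locus where `g` is
  -- invertible such that `g ^ n • s` extends to `U`
  let S : ℕ →o Submodule Γ(X, W) (κ → Γ(X, W)) :=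
    { toFun n :=
        { carrier := {v | ∃ s : F.presheaf.obj (op (Y.basicOpen g)),
            (∀ k, f.appLE W _ hgW d * evalApp (φ k) hgU s = f.appLE W _ hgW (v k)) ∧
            ∃ t, res F hgU t = fres hgU g ^ n • s}
          add_mem' := by
            rintro v v' ⟨s, hs, t, ht⟩ ⟨s', hs', t', ht'⟩
            exact ⟨s + s', fun k => by rw [map_add, mul_add, hs, hs', Pi.add_apply, map_add],
              t + t', by rw [map_add, ht, ht', smul_add]⟩
          zero_mem' := ⟨0, fun k => by rw [map_zero, mul_zero, Pi.zero_apply, map_zero], 0, by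
            rw [map_zero, smul_zero]⟩
          smul_mem' := by
            rintro c v ⟨s, hs, t, ht⟩
            refine ⟨f.appLE W _ hgW c • s, fun k => ?_, f.appLE W U hUW c • t, ?_⟩
            · rw [map_smul, smul_eq_mul, mul_left_comm, hs, Pi.smul_apply, smul_eq_mul, map_mul]
            · rw [map_smulₛₗ, ht, fres_appLE, smul_comm] }
      monotone' := by
        rintro n n' hn v ⟨s, hs, t, ht⟩
        refine ⟨s, hs, g ^ (n' - n) • t, ?_⟩
        rw [map_smulₛₗ, ht, map_pow, ← mul_smul, ← pow_add, Nat.sub_add_cancel hn] }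
  obtain ⟨n, hn⟩ := monotone_stabilizes_iff_noetherian.mpr
    (inferInstance : IsNoetherian Γ(X, W) (κ → Γ(X, W))) S
  refine ⟨n, fun s => ?_⟩
  choose v hv using hdφ s _ hgU hgE hne
  obtain ⟨n', t', ht'⟩ := exists_res_eq_pow_smul hU hirr hfg htl g (res F hgE s)
  have hvS : v ∈ S n := by
    rcases le_total n n' with h | h
    · rw [hn n' h]
      exact ⟨_, hv, t', ht'⟩
    · exact S.monotone h ⟨_, hv, t', ht'⟩
  obtain ⟨s', hs', t, ht⟩ := hvS
  have : s' = res F hgE s := by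
    rw [← sub_eq_zero]
    refine hφ _ hgU _ fun k => ?_
    rw [map_sub, sub_eq_zero]
    exact fun_mul_left_cancel hirr hgU hd' ((hs' k).trans (hv k).symm)
  exact ⟨t, this ▸ ht⟩

end

/-! ### Extension of sections of the twists -/

section
variable {X Y : Scheme.{u}}

lemma nonempty_inf_openCompl {f : Y ⟶ X} (hf : IsBirational f) {E : Closeds Y}
    (hE : (E : Set Y) ⊆ exceptionalLocus f) {U : Y.Opens} (hU : (U : Set Y).Nonempty) :
    ((U ⊓ openCompl E : Y.Opens) : Set Y).Nonempty := by
  obtain ⟨U₀, -, hU₀', _⟩ := hf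
  obtain ⟨y, hy, hyU⟩ := hU₀'.inter_open_nonempty _ U.2 hU
  exact ⟨y, hy, fun h => notMem_exceptionalLocus (f := f) (U := U₀) hyU (hE h)⟩

/-- An affine chart adapted to the divisor `E` and the module `F`: it is irreducible and not
contained in `E`, the divisor has the equation `g`, and `F` is torsionless. -/
structure IsChart (E : Closeds Y) (F : Y.PresheafOfModules) (U : Y.Opens) (g : Γ(Y, U)) : Prop where
  isAffineOpen : IsAffineOpen U
  isPreirreducible : IsPreirreducible (U : Set Y)
  torsionless : Torsionless F U
  reducedIdeal_eq : reducedIdeal E U = Ideal.span {g}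
  nonempty : ((U ⊓ openCompl E : Y.Opens) : Set Y).Nonempty

/-- On the chart `U` with equation `g` of `E`, every section of `F` off `E` has a pole of order at
most `n` along `E`. -/
def HasPoleBound (E : Closeds Y) (F : Y.PresheafOfModules) {U : Y.Opens} (g : Γ(Y, U)) (n : ℕ) :
    Prop :=
  ∀ s : F.presheaf.obj (op (openCompl E)), ∃ t : F.presheaf.obj (op U),
    res F (inf_le_left : U ⊓ openCompl E ≤ U) t =
      fres (inf_le_left : U ⊓ openCompl E ≤ U) g ^ n •
        res F (inf_le_right : U ⊓ openCompl E ≤ openCompl E) s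

lemma exists_chart [IsLocallyNoetherian X] [IsLocallyNoetherian Y] [CompactSpace Y]
    (hX : IsNormal X) (hY : IsNormal Y) (f : Y ⟶ X) [IsProper f] (hf : IsBirational f)
    {F : Y.PresheafOfModules} (hF : LocallyFinGenTorsionless F) (E : Closeds Y)
    (hE : (E : Set Y) ⊆ exceptionalLocus f) (hE' : IsCartier E) (y : Y) :
    ∃ (U : Y.Opens) (g : Γ(Y, U)), y ∈ U ∧ IsChart E F U g ∧ ∃ n : ℕ, HasPoleBound E F g n := by
  have := hY.isReduced
  obtain ⟨W, hW, hyW, -, _⟩ := exists_isAffineOpen_isDomain hX (f y) (V := ⊤) trivial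
  obtain ⟨N, hyN, hfg, htl⟩ := hF y
  obtain ⟨U₁, hU₁, hyU₁, -, _⟩ := exists_isAffineOpen_isDomain hY y (V := ⊤) trivial
  obtain ⟨U₀, hU₀, hyU₀, g, -, hg⟩ := hE' y
  obtain ⟨b, hb, hyb⟩ := hU₀.exists_basicOpen_le (V := N ⊓ U₁ ⊓ f ⁻¹ᵁ W)
    ⟨y, ⟨hyN, hyU₁⟩, hyW⟩ hyU₀
  have hirr : IsPreirreducible (Y.basicOpen b : Set Y) :=
    (isIrreducible_of_isDomain hU₁).2.open_subset (Y.basicOpen b).2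
      (hb.trans (inf_le_left.trans inf_le_right))
  have hI := reducedIdeal_basicOpen E hU₀ hg b
  have haff := hU₀.basicOpen b
  have hgE := basicOpen_eq_of_reducedIdeal E haff hI
  have hne := nonempty_inf_openCompl hf hE (U := Y.basicOpen b) ⟨y, hyb⟩
  have htl' := htl.mono (hb.trans (inf_le_left.trans inf_le_left))
  refine ⟨Y.basicOpen b, _, hyb, ⟨haff, hirr, htl', hI, hne⟩, ?_⟩
  obtain ⟨n, hn⟩ := exists_uniform_pow hX f hf hF E hE hW (hb.trans inf_le_right) haff hirr
    (hfg.mono (hb.trans (inf_le_left.trans inf_le_left))) htl' (fres (Y.basicOpen_le b) g)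
    (hgE.le.trans inf_le_right) (by rw [hgE]; exact hne)
  refine ⟨n, fun s => ?_⟩
  obtain ⟨t, ht⟩ := hn s
  refine ⟨t, ?_⟩
  have := congrArg (res F hgE.ge) ht
  rwa [map_smulₛₗ, res_res, res_res, map_pow, fres_fres] at this

lemma exists_forall_chart [IsLocallyNoetherian X] [IsLocallyNoetherian Y] [CompactSpace Y]
    (hX : IsNormal X) (hY : IsNormal Y) (f : Y ⟶ X) [IsProper f] (hf : IsBirational f)
    {F : Y.PresheafOfModules} (hF : LocallyFinGenTorsionless F) (E : Closeds Y)
    (hE : (E : Set Y) ⊆ exceptionalLocus f) (hE' : IsCartier E) :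
    ∃ a₀ : ℕ, ∀ y : Y, ∃ (U : Y.Opens) (g : Γ(Y, U)), y ∈ U ∧ IsChart E F U g ∧
      ∀ a ≥ a₀, HasPoleBound E F g a := by
  choose U g hyU hU n hn using exists_chart hX hY f hf hF E hE hE'
  obtain ⟨T, hT⟩ := isCompact_univ.elim_finite_subcover (fun y => (U y : Set Y)) (fun y => (U y).2)
    (fun y _ => Set.mem_iUnion.2 ⟨y, hyU y⟩)
  refine ⟨T.sup n, fun y => ?_⟩
  obtain ⟨y₀, hy₀, hyU₀⟩ : ∃ y₀ ∈ T, y ∈ U y₀ := by simpa using hT (Set.mem_univ y)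
  refine ⟨U y₀, g y₀, hyU₀, hU y₀, fun a ha s => ?_⟩
  obtain ⟨t, ht⟩ := hn y₀ s
  refine ⟨g y₀ ^ (a - n y₀) • t, ?_⟩
  rw [map_smulₛₗ, ht, map_pow, ← mul_smul, ← pow_add,
    Nat.sub_add_cancel ((Finset.le_sup hy₀).trans ha)]

lemma reducedIdeal_eq_top (E : Closeds Y) {V : Y.Opens} (hV : V ≤ openCompl E) :
    reducedIdeal E V = ⊤ := by
  rw [Ideal.eq_top_iff_one, mem_reducedIdeal_iff]
  exact fun y hy hyE => (hV hy hyE).elim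

/-- A section of `I ^ a` as a function. -/
def idealVal {E : Closeds Y} {a : ℕ} {V : Y.Opens}
    (p : (idealPowerPresheaf E a).presheaf.obj (op V)) : Γ(Y, V) := Subtype.val p

/-- If sections of `F` off `E` acquire, locally on `Y`, poles of order at most `a` along `E`, then
sections of `F(aE)` off `E` extend to `Y`. -/
lemma twist_map_surjective [IsReduced Y] (F : Y.Modules) (E : Closeds Y) (a : ℕ)
    (h : ∀ y : Y, ∃ (U : Y.Opens) (g : Γ(Y, U)), y ∈ U ∧ IsChart E F.val U g ∧
      HasPoleBound E F.val g a) :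
    Function.Surjective ((toAb (twist F E a)).obj.map
      (homOfLE (le_top : openCompl E ≤ (⊤ : Y.Opens))).op) := by
  intro φ₀
  let φ : homSections (idealPowerPresheaf E a) F (openCompl E) := φ₀
  -- off `E` the ideal sheaf is trivial, so `φ` is multiplication by the section `s = φ 1`
  have h1 : (1 : Γ(Y, openCompl E)) ∈ reducedIdeal E (openCompl E) ^ a := by
    rw [reducedIdeal_eq_top E le_rfl, Ideal.top_pow]
    trivial
  let one : (idealPowerPresheaf E a).presheaf.obj (op (openCompl E)) :=
    (⟨1, h1⟩ : (reducedIdeal E (openCompl E) ^ a : Ideal Γ(Y, openCompl E)))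
  let s := homApp φ le_rfl one
  have hφ : ∀ (V : Y.Opens) (hV : V ≤ openCompl E) p,
      homApp φ hV p = idealVal p • res F.val hV s := by
    intro V hV p
    rw [← homApp_res φ le_rfl hV one, ← map_smul]
    congr 1
    refine Subtype.ext ?_
    change idealVal p = idealVal p * fres hV 1
    rw [map_one, mul_one]
  have hinj : ∀ V ≤ (⊤ : Y.Opens),
      Function.Injective (res F.val (inf_le_left : V ⊓ openCompl E ≤ V)) := by
    intro V _ x x' hx
    refine eq_of_locally_res_eq F fun y hy => ?_
    obtain ⟨U, g, hyU, hU, -⟩ := h y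
    refine ⟨V ⊓ U, inf_le_left, ⟨hy, hyU⟩, ?_⟩
    refine hU.torsionless.res_inf_injective hU.isPreirreducible inf_le_right inf_le_left
      hU.nonempty ?_
    have := congrArg (res F.val (show V ⊓ U ⊓ (U ⊓ openCompl E) ≤ V ⊓ openCompl E from
      inf_le_inf inf_le_left inf_le_right)) hx
    simpa only [res_res] using this
  obtain ⟨ψ, hψ⟩ := exists_homSections_extend (U := ⊤) hinj φ (by
    intro V hV p y hy
    obtain ⟨U, g, hyU, hU, ht⟩ := h y
    obtain ⟨b, hb, hyb⟩ := hU.isAffineOpen.exists_basicOpen_le ⟨y, hy⟩ hyU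
    obtain ⟨t, ht⟩ := ht s
    have hp : idealVal (res (idealPowerPresheaf E a) hb p) ∈ reducedIdeal E (Y.basicOpen b) ^ a :=
      Subtype.property (res (idealPowerPresheaf E a) hb p)
    rw [reducedIdeal_basicOpen E hU.isAffineOpen hU.reducedIdeal_eq, Ideal.span_singleton_pow,
      Ideal.mem_span_singleton] at hp
    obtain ⟨c, hc⟩ := hp
    refine ⟨Y.basicOpen b, hb, hyb, c • res F.val (Y.basicOpen_le b) t, ?_⟩
    rw [hφ, map_smulₛₗ, res_res, ← res_res F.val
      (inf_le_inf_right (openCompl E) (Y.basicOpen_le b)) inf_le_left, ht, map_smulₛₗ, res_res,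
      ← mul_smul]
    congr 1
    change _ = fres (inf_le_left.trans hb) (idealVal p)
    rw [← fres_fres inf_le_left hb]
    change _ = fres inf_le_left (idealVal (res (idealPowerPresheaf E a) hb p))
    rw [hc, map_mul, map_pow, map_pow, fres_fres, fres_fres, mul_comm])
  exact ⟨ψ, Subtype.ext (funext fun V => LinearMap.ext fun p => hψ V.1 le_top V.2 p)⟩

/-- The injectivity statement for an arbitrary locally finitely generated and torsionless sheaf and
an arbitrary Cartier divisor in the exceptional locus. -/
theorem exists_forall_HSuppToH_injective [IsLocallyNoetherian X] [IsLocallyNoetherian Y]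
    [CompactSpace Y] (hX : IsNormal X) (hY : IsNormal Y) (f : Y ⟶ X) [IsProper f]
    (hf : IsBirational f) (F : Y.Modules) (hF : LocallyFinGenTorsionless F.val) (E : Closeds Y)
    (hE : (E : Set Y) ⊆ exceptionalLocus f) (hE' : IsCartier E) :
    ∃ a₀ : ℕ, ∀ a ≥ a₀, Function.Injective (HSuppToH E (toAb (twist F E a)) 1) := by
  have := hY.isReduced
  obtain ⟨a₀, h⟩ := exists_forall_chart hX hY f hf hF E hE hE'
  refine ⟨a₀, fun a ha => HSuppToH_injective E _ (twist_map_surjective F E a fun y => ?_)⟩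
  obtain ⟨U, g, hyU, hU, ht⟩ := h y
  exact ⟨U, g, hyU, hU, ht a ha⟩

lemma locallyFinGenTorsionless_reflexivePower [IsLocallyNoetherian Y] (hY : IsNormal Y)
    {M : Y.Modules} (hM : ∀ y : Y, ∃ U : Y.Opens, y ∈ U ∧ FinGen M.val U) (m : ℕ) :
    LocallyFinGenTorsionless (reflexivePower M m).val := by
  have := hY.isReduced
  intro y
  obtain ⟨N, hyN, hN⟩ := hM y
  obtain ⟨U, hU, hyU, hUN, _⟩ := exists_isAffineOpen_isDomain hY y hyN
  have : IsNoetherianRing Γ(Y, U) := IsLocallyNoetherian.component_noetherian ⟨U, hU⟩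
  have h := (finGen_presheafTensorPower (hN.mono hUN) m).dual hU
  exact ⟨U, hyU, h.dual hU, h.torsionless_dual⟩

lemma locallyFinGenTorsionless_tensorPower {M : Y.Modules} (hM : IsInvertible M) (m : ℕ) :
    LocallyFinGenTorsionless (tensorPower M m).val := by
  intro y
  obtain ⟨U, hyU, e, he⟩ := hM.exists_isBasis y
  obtain ⟨e', he'⟩ := he.exists_presheafTensorPower m
  exact ⟨U, hyU, ⟨Unit, inferInstance, _, he'.generates.sheafify⟩, he'.torsionless_sheafify⟩

end

end
end PluriCanon

theorem proposition3p4 {X Y : Scheme.{u}} [IsNoetherian X] [IsNoetherian Y]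
    (hX : PluriCanon.IsNormal X) (hY : PluriCanon.IsNormal Y) (f : Y ⟶ X) [IsProper f] (hf : PluriCanon.IsBirational f)
    (hE : PluriCanon.IsCartier (PluriCanon.exceptionalDivisor f)) (ω : Y.Modules) (hω : PluriCanon.IsDualizingSheaf ω) (m : ℕ)
    (hm : 0 < m) :
    (∃ a₀ : ℕ, ∀ a ≥ a₀, Function.Injective
      (PluriCanon.HSuppToH (PluriCanon.exceptionalDivisor f)
        (PluriCanon.toAb (PluriCanon.twist (PluriCanon.reflexivePower ω m) (PluriCanon.exceptionalDivisor f) a)) 1)) ∧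
    (PluriCanon.IsInvertible ω → ∃ a₀ : ℕ, ∀ a ≥ a₀, Function.Injective
      (PluriCanon.HSuppToH (PluriCanon.exceptionalDivisor f)
        (PluriCanon.toAb (PluriCanon.twist (PluriCanon.tensorPower ω m) (PluriCanon.exceptionalDivisor f) a)) 1)) :=
  ⟨PluriCanon.exists_forall_HSuppToH_injective hX hY f hf _
      (PluriCanon.locallyFinGenTorsionless_reflexivePower hY (PluriCanon.exists_finGen ω hω.1) m) _
      (PluriCanon.exceptionalDivisor_subset f) hE,
    fun h => PluriCanon.exists_forall_HSuppToH_injective hX hY f hf _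
      (PluriCanon.locallyFinGenTorsionless_tensorPower h m) _
      (PluriCanon.exceptionalDivisor_subset f) hE⟩
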